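/- Consider the scale-mixture-of-skew-normal linear mixed model for subjects $i=1,\dots,n$, $$\mathbf Y_i=\mathbf X_i\beta+\mathbf Z_i\mathbf b_i+\epsilon_i ,$$ with fixed design matrices $\mathbf X_i\in\mathbb R^{n_i\times l}$, $\mathbf Z_i\in\mathbb R^{n_i\times q}$, where $\beta\in\mathbb R^l$, $\lambda\in\mathbb R^q$, and $\mathbf D\in\mathbb R^{q\times q}$, $\Sigma_i\in\mathbb R^{n_i\times n_i}$ are symmetric positive definite. The triples $(U_i,\mathbf b_i,\epsilon_i)$ are independent over $i$; $U_i>0$ has law $H$ with $k_1=\mathrm E\{U_i^{-1/2}\}<\infty$; and, given $U_i=u$, the vector $(\mathbf b_i^\top,\epsilon_i^\top)^\top$ has the density on $\mathbb R^{q+n_i}$ $$w\mapsto 2\,\phi_{q+n_i}(w;\mu,u^{-1}S_i)\,\Phi\!\left(u^{1/2}\,\tilde\lambda^\top S_i^{-1/2}(w-\mu)\right),\qquad \mu=\begin{pmatrix}c\Delta\\0\end{pmatrix},\quad S_i=\begin{pmatrix}\mathbf D&0\\0&\Sigma_i\end{pmatrix},\quad \tilde\lambda=\begin{pmatrix}\lambda\\0\end{pmatrix},$$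 that is, $(\mathbf b_i^\top,\epsilon_i^\top)^\top\sim\mathrm{SMSN}_{q+n_i}(\mu,S_i,\tilde\lambda;H)$ with mixing factor $U_i$. Here $\phi_p(\cdot;\mu,S)$ is the $p$-variate normal density, $\phi$ and $\Phi$ are the standard normal density and distribution function, square roots of matrices are the symmetric positive definite ones, $c=-\sqrt{2/\pi}\,k_1$, $\Delta=\mathbf D^{1/2}\delta$ and $\delta=\lambda/\sqrt{1+\lambda^\top\lambda}$. Put $$\Psi_i=\Sigma_i+\mathbf Z_i\mathbf D\mathbf Z_i^\top,\quad \zeta=\mathbf D^{-1/2}\lambda,\quad \Lambda_i=(\mathbf D^{-1}+\mathbf Z_i^\top\Sigma_i^{-1}\mathbf Z_i)^{-1},\quad \bar\lambda_i=\frac{\Psi_i^{-1/2}\mathbf Z_i\mathbf D\zeta}{\sqrt{1+\zeta^\top\Lambda_i\zeta}},$$ and, for $\mathbf y_i\in\mathbb R^{n_i}$, $$\mathbf y_{0i}=\Psi_i^{-1/2}(\mathbf y_i-\mathbf X_i\beta-c\mathbf Z_i\Delta),\quad A_i=\bar\lambda_i^\top\mathbf y_{0i},\quad \mu_{bi}=c\Delta+\mathbf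 D\mathbf Z_i^\top\Psi_i^{-1/2}\mathbf y_{0i},$$ $$\tau_{-1i}=\mathrm E\{U_i^{-1/2}W_\Phi(U_i^{1/2}A_i)\mid\mathbf Y_i=\mathbf y_i\},\qquad W_\Phi=\phi/\Phi .$$ Then, for every $i$, $\mathbf b_i$ is integrable, and the conditional mean $\mathbf y_i\mapsto\mathrm E\{\mathbf b_i\mid\mathbf Y_i=\mathbf y_i\}$ is the minimum mean-squared-error predictor of $\mathbf b_i$ from $\mathbf Y_i$: it minimizes $\mathrm E\|\mathbf b_i-g(\mathbf Y_i)\|^2\in[0,\infty]$ over all measurable $g:\mathbb R^{n_i}\to\mathbb R^q$, and if the minimum is finite, any other minimizer agrees with it almost surely. Moreover, for almost every $\mathbf y_i$ with respect to the law of $\mathbf Y_i$, the conditional means $\mathrm E\{\mathbf b_i\mid\mathbf Y_i=\mathbf y_i\}$ and $\tau_{-1i}$ exist (as absolutely convergent integrals) and $$\mathrm E\{\mathbf b_i\mid\mathbf Y_i=\mathbf y_i\}=\mathrm E\bigl\{\mathrm E\{\mathbf b_i\mid U_i,\mathbf Y_i=\mathbf y_i\}\mid\mathbf Y_i=\mathbf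 y_i\bigr\}=\mu_{bi}+\frac{\tau_{-1i}}{\sqrt{1+\zeta^\top\Lambda_i\zeta}}\,\Lambda_i\zeta .$$ -/

import Mathlib

open MeasureTheory ProbabilityTheory Matrix
open scoped MatrixOrder ENNReal

noncomputable section

namespace SkewLMM

/-! ### Square roots and normal densities -/

/-- `S^{1/2}`: the symmetric positive semidefinite square root of a positive definite matrix. -/
def sqrtM {ι : Type*} [Fintype ι] [DecidableEq ι] (S : Matrix ι ι ℝ) : Matrix ι ι ℝ :=
  CFC.sqrt S

/-- `S^{-1/2}`: the symmetric matrix with `S^{-1/2} S^{-1/2} = S⁻¹`. -/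
def invSqrtM {ι : Type*} [Fintype ι] [DecidableEq ι] (S : Matrix ι ι ℝ) : Matrix ι ι ℝ :=
  CFC.sqrt S⁻¹

/-- `φ_p(y; μ, S)`: the density of the `p`-variate normal law with mean `μ` and positive definite
covariance matrix `S`. -/
def normalPDF {ι : Type*} [Fintype ι] [DecidableEq ι] (μ : ι → ℝ) (S : Matrix ι ι ℝ)
    (y : ι → ℝ) : ℝ :=
  (Real.sqrt ((2 * Real.pi) ^ Fintype.card ι * S.det))⁻¹ *
    Real.exp (-((y - μ) ⬝ᵥ S⁻¹ *ᵥ (y - μ)) / 2)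

/-- `Φ`: the standard normal cumulative distribution function. -/
def stdNormalCDF (x : ℝ) : ℝ := cdf (gaussianReal 0 1) x

/-- `W_Φ(x) = φ(x) / Φ(x)` for the standard normal density `φ` and distribution function `Φ`. -/
def WPhi (x : ℝ) : ℝ := gaussianPDFReal 0 1 x / stdNormalCDF x

/-! ### Scale mixtures of skew-normal laws -/

/-- The density of `SN_p(μ, u⁻¹ S, lam)`,
`2 φ_p(w; μ, u⁻¹ S) Φ(u^{1/2} lamᵀ S^{-1/2} (w - μ))`, for `u > 0`. -/
def scaledSkewNormalPDF {ι : Type*} [Fintype ι] [DecidableEq ι] (μ : ι → ℝ) (S : Matrix ι ι ℝ)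
    (lam : ι → ℝ) (u : ℝ) (w : ι → ℝ) : ℝ :=
  2 * normalPDF μ (u⁻¹ • S) w *
    stdNormalCDF (Real.sqrt u * (lam ⬝ᵥ invSqrtM S *ᵥ (w - μ)))

/-- `W ~ SMSN_p(μ, S, lam; H)` with mixing factor `U`: `U` has law `H` and, given `U = u`, `W` has
law `SN_p(μ, u⁻¹ S, lam)`. That is, `(U, W)` has the joint density
`2 φ_p(w; μ, u⁻¹ S) Φ(u^{1/2} lamᵀ S^{-1/2} (w - μ))` with respect to `H(du) dw`. Integrating `u`
out gives the density `2 ∫ φ_p(w; μ, u⁻¹ S) Φ(u^{1/2} lamᵀ S^{-1/2} (w - μ)) dH(u)` of `W`. -/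
def IsSMSN {Ω : Type*} [MeasurableSpace Ω] {ι : Type*} [Fintype ι] [DecidableEq ι]
    (P : Measure Ω) (U : Ω → ℝ) (W : Ω → ι → ℝ)
    (μ : ι → ℝ) (S : Matrix ι ι ℝ) (lam : ι → ℝ) (H : Measure ℝ) : Prop :=
  P.map (fun ω => (U ω, W ω)) =
    (H.prod (volume : Measure (ι → ℝ))).withDensity
      (fun p => ENNReal.ofReal (scaledSkewNormalPDF μ S lam p.1 p.2))

/-! ### The linear mixed model -/

/-- Design matrices and parameters of a linear mixed model with SMSN random terms, for `n` subjects
with `m i` observations on subject `i`, `l` fixed effects and `q` random effects. -/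
structure Params (n q l : ℕ) (m : Fin n → ℕ) where
  /-- fixed effects design matrices -/
  X : (i : Fin n) → Matrix (Fin (m i)) (Fin l) ℝ
  /-- random effects design matrices -/
  Z : (i : Fin n) → Matrix (Fin (m i)) (Fin q) ℝ
  /-- fixed effects -/
  beta : Fin l → ℝ
  /-- scale matrix of the random effects -/
  D : Matrix (Fin q) (Fin q) ℝ
  /-- scale matrices of the errors -/
  Sig : (i : Fin n) → Matrix (Fin (m i)) (Fin (m i)) ℝ
  /-- skewness parameter -/
  lam : Fin q → ℝ
  /-- law of the mixing factors -/
  H : Measure ℝ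
  posDef_D : D.PosDef
  posDef_Sig : ∀ i, (Sig i).PosDef
  isProbabilityMeasure_H : IsProbabilityMeasure H
  /-- the mixing factor is positive -/
  H_nonpos : H (Set.Iic 0) = 0
  /-- `E[U^{-1/2}]` is finite -/
  integrable_k1 : Integrable (fun u : ℝ => (Real.sqrt u)⁻¹) H

namespace Params

variable {n q l : ℕ} {m : Fin n → ℕ} (M : Params n q l m)

/-- `k₁ = E[U^{-1/2}]` -/
def k1 : ℝ := ∫ u, (Real.sqrt u)⁻¹ ∂M.H

/-- `c = -√(2/π) k₁` -/
def c : ℝ := -Real.sqrt (2 / Real.pi) * M.k1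

/-- `δ = lam / √(1 + lamᵀ lam)` -/
def delta : Fin q → ℝ := (Real.sqrt (1 + M.lam ⬝ᵥ M.lam))⁻¹ • M.lam

/-- `Δ = D^{1/2} δ` -/
def Delta : Fin q → ℝ := sqrtM M.D *ᵥ M.delta

/-- `Ψ_i = Σ_i + Z_i D Z_iᵀ` -/
def Psi (i : Fin n) : Matrix (Fin (m i)) (Fin (m i)) ℝ := M.Sig i + M.Z i * M.D * (M.Z i)ᵀ

/-- `ζ = D^{-1/2} lam` -/
def zeta : Fin q → ℝ := invSqrtM M.D *ᵥ M.lam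

/-- `Λ_i = (D⁻¹ + Z_iᵀ Σ_i⁻¹ Z_i)⁻¹` -/
def Lambda (i : Fin n) : Matrix (Fin q) (Fin q) ℝ :=
  (M.D⁻¹ + (M.Z i)ᵀ * (M.Sig i)⁻¹ * M.Z i)⁻¹

/-- `√(1 + ζᵀ Λ_i ζ)` -/
def s (i : Fin n) : ℝ := Real.sqrt (1 + M.zeta ⬝ᵥ M.Lambda i *ᵥ M.zeta)

/-- `Ψ_i^{-1/2} Z_i D ζ / √(1 + ζᵀ Λ_i ζ)` -/
def lamBar (i : Fin n) : Fin (m i) → ℝ :=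
  (M.s i)⁻¹ • ((invSqrtM (M.Psi i) * M.Z i * M.D) *ᵥ M.zeta)

/-- `y_{0i} = Ψ_i^{-1/2} (y_i - X_i β - c Z_i Δ)` -/
def y0 (i : Fin n) (y : Fin (m i) → ℝ) : Fin (m i) → ℝ :=
  invSqrtM (M.Psi i) *ᵥ (y - M.X i *ᵥ M.beta - M.c • (M.Z i *ᵥ M.Delta))

/-- `A_i`, the inner product of `lamBar i` and `y_{0i}` -/
def A (i : Fin n) (y : Fin (m i) → ℝ) : ℝ := M.lamBar i ⬝ᵥ M.y0 i y

/-- `μ_{bi} = c Δ + D Z_iᵀ Ψ_i^{-1/2} y_{0i}` -/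
def muB (i : Fin n) (y : Fin (m i) → ℝ) : Fin q → ℝ :=
  M.c • M.Delta + (M.D * (M.Z i)ᵀ * invSqrtM (M.Psi i)) *ᵥ M.y0 i y

/-- The random effects `b i`, errors `e i`, mixing factors `U i` and responses `Y i` follow the
model: `Y_i = X_i β + Z_i b_i + e_i`, the triples `(U_i, b_i, e_i)` are independent across
subjects, and `(b_i, e_i)` is SMSN with location `(c Δ, 0)`, scale matrix `diag(D, Σ_i)`,
skewness `(lam, 0)` and mixing factor `U_i` of law `H`. -/
structure IsModel {Ω : Type*} [MeasurableSpace Ω] (P : Measure Ω)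
    (b : Fin n → Ω → Fin q → ℝ) (e : (i : Fin n) → Ω → Fin (m i) → ℝ)
    (U : Fin n → Ω → ℝ) (Y : (i : Fin n) → Ω → Fin (m i) → ℝ) : Prop where
  measurable_b : ∀ i, Measurable (b i)
  measurable_e : ∀ i, Measurable (e i)
  measurable_U : ∀ i, Measurable (U i)
  response : ∀ i ω, Y i ω = M.X i *ᵥ M.beta + M.Z i *ᵥ b i ω + e i ω
  indep : iIndepFun (fun i ω => (U i ω, b i ω, e i ω)) P
  smsn : ∀ i, IsSMSN P (U i) (fun ω => Sum.elim (b i ω) (e i ω))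
    (Sum.elim (M.c • M.Delta) 0) (Matrix.fromBlocks M.D 0 0 (M.Sig i)) (Sum.elim M.lam 0) M.H

end Params

/-! ### Conditional means and mean squared error -/

/-- `E[V | Y = y]`: the mean of the regular conditional distribution of `V` given `Y = y`. -/
def condMean {Ω : Type*} [MeasurableSpace Ω] (P : Measure Ω) [IsFiniteMeasure P]
    {q : ℕ} {β : Type*} [MeasurableSpace β] (V : Ω → Fin q → ℝ) (Y : Ω → β) (y : β) : Fin q → ℝ :=
  ∫ v, v ∂(condDistrib V Y P y)

/-- The mean squared error `E ‖V - g(Y)‖²` (Euclidean norm), in `[0, ∞]`. -/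
def mse {Ω : Type*} [MeasurableSpace Ω] (P : Measure Ω) {q k : ℕ}
    (V : Ω → Fin q → ℝ) (Y : Ω → Fin k → ℝ) (g : (Fin k → ℝ) → Fin q → ℝ) : ℝ≥0∞ :=
  ∫⁻ ω, ENNReal.ofReal (∑ j, (V ω j - g (Y ω) j) ^ 2) ∂P

/-- `g(Y)` is the minimum mean squared error predictor of `V` from `Y`: `g` minimizes the mean
squared error among all measurable functions and, if the minimum is finite, every other minimizer
agrees with `g` almost surely. -/
def IsMinMSEPredictor {Ω : Type*} [MeasurableSpace Ω] (P : Measure Ω) {q k : ℕ}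
    (V : Ω → Fin q → ℝ) (Y : Ω → Fin k → ℝ) (g : (Fin k → ℝ) → Fin q → ℝ) : Prop :=
  Measurable g ∧
  ∀ h : (Fin k → ℝ) → Fin q → ℝ, Measurable h →
    mse P V Y g ≤ mse P V Y h ∧
    (mse P V Y g ≠ ∞ → mse P V Y h = mse P V Y g → h =ᵐ[P.map Y] g)

/-- The integrand `u^{-1/2} W_Φ(u^{1/2} A)` of `τ_{-1i}`. -/
def tauIntegrand (A u : ℝ) : ℝ := (Real.sqrt u)⁻¹ * WPhi (Real.sqrt u * A)

/-- `E[U^{-1/2} W_Φ(U^{1/2} A(y)) | Y = y]`, an integral over the conditional law of `U`. -/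
def tauNegOne {Ω : Type*} [MeasurableSpace Ω] (P : Measure Ω) [IsFiniteMeasure P]
    {k : ℕ} (U : Ω → ℝ) (Y : Ω → Fin k → ℝ) (A : (Fin k → ℝ) → ℝ) (y : Fin k → ℝ) : ℝ :=
  ∫ u, tauIntegrand (A y) u ∂(condDistrib U Y P y)

end SkewLMM

end

noncomputable section

namespace SkewLMM

/-!
Given `U = u`, completing the square in the joint density of `(b, Y)` writes it, as a function of
`b`, as a constant times a Gaussian factor centred at the posterior mean `μ_b` with covariance
`u⁻¹ Λ`, times `Φ` of an affine function of `b`. After standardization, its mean is governed by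
the ratio of `∫ Φ(κ + aᵀz) z dγ` to `∫ Φ(κ + aᵀz) dγ = Φ(κ / √(1 + aᵀa))`, `γ` being the standard
normal law. Stein's identity turns the numerator into `a` times the derivative of the denominator
in `κ`, so the ratio is `W_Φ(κ / √(1 + aᵀa)) a / √(1 + aᵀa)`. This gives `E[b | U, Y]`, and the
tower property gives `E[b | Y]`.

Integrability of `b` comes from the stochastic representation: `U^{1/2} S^{-1/2} ((b, e) - μ)` is
standard skew-normal and independent of `U`, so `E[U^{-1/2}] < ∞` is all that is needed. It does
not give a second moment, hence the minimality of the mean squared error is a Pythagoras argument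
in which `b - g(Y)`, rather than `b` itself, is square integrable.
-/

/-! ### The standard normal distribution function -/

section NormalCDF

lemma stdNormalCDF_eq_integral (x : ℝ) :
    stdNormalCDF x = ∫ t in Set.Iic x, gaussianPDFReal 0 1 t := by
  rw [stdNormalCDF, cdf_eq_real, measureReal_def, gaussianReal_apply_eq_integral _ one_ne_zero,
    ENNReal.toReal_ofReal (integral_nonneg fun t => gaussianPDFReal_nonneg _ _ _)]

@[fun_prop]
lemma continuous_gaussianPDFReal (μ : ℝ) (v : NNReal) : Continuous (gaussianPDFReal μ v) := by
  unfold gaussianPDFReal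
  fun_prop

lemma gaussianPDFReal_le (μ : ℝ) (v : NNReal) (x : ℝ) :
    gaussianPDFReal μ v x ≤ (Real.sqrt (2 * Real.pi * v))⁻¹ :=
  mul_le_of_le_one_right (by positivity) <| Real.exp_le_one_iff.2 <|
    div_nonpos_of_nonpos_of_nonneg (neg_nonpos.2 (sq_nonneg _)) (by positivity)

lemma hasDerivAt_stdNormalCDF (x : ℝ) :
    HasDerivAt stdNormalCDF (gaussianPDFReal 0 1 x) x := by
  have hi := integrable_gaussianPDFReal 0 1
  have h : stdNormalCDF = fun y => (∫ t in (0 : ℝ)..y, gaussianPDFReal 0 1 t) + stdNormalCDF 0 := by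
    ext y
    rw [stdNormalCDF_eq_integral, stdNormalCDF_eq_integral,
      ← intervalIntegral.integral_Iic_sub_Iic hi.integrableOn hi.integrableOn, sub_add_cancel]
  rw [h]
  exact (intervalIntegral.integral_hasDerivAt_right hi.intervalIntegrable
    (stronglyMeasurable_gaussianPDFReal 0 1).stronglyMeasurableAtFilter
    (continuous_gaussianPDFReal 0 1).continuousAt).add_const _

@[fun_prop]
lemma continuous_stdNormalCDF : Continuous stdNormalCDF :=
  continuous_iff_continuousAt.2 fun x => (hasDerivAt_stdNormalCDF x).continuousAt

lemma stdNormalCDF_pos (x : ℝ) : 0 < stdNormalCDF x := by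
  rw [stdNormalCDF_eq_integral, setIntegral_pos_iff_support_of_nonneg_ae
    (ae_of_all _ fun t => gaussianPDFReal_nonneg _ _ _)
    (integrable_gaussianPDFReal 0 1).integrableOn,
    Function.support_eq_univ fun t => (gaussianPDFReal_pos 0 1 t one_ne_zero).ne', Set.univ_inter]
  simp

lemma stdNormalCDF_le_one (x : ℝ) : stdNormalCDF x ≤ 1 := cdf_le_one _ _

lemma norm_stdNormalCDF_le_one (x : ℝ) : ‖stdNormalCDF x‖ ≤ 1 := by
  rw [Real.norm_of_nonneg (stdNormalCDF_pos x).le]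
  exact stdNormalCDF_le_one x

lemma gaussianReal_real_Iic {v : NNReal} (hv : 0 < v) (κ : ℝ) :
    (gaussianReal 0 v).real (Set.Iic κ) = stdNormalCDF (κ / Real.sqrt v) := by
  have hsv : 0 < Real.sqrt v := Real.sqrt_pos.2 hv
  have hmap : (gaussianReal 0 v).map (· / Real.sqrt v) = gaussianReal 0 1 := by
    rw [gaussianReal_map_div_const, zero_div]
    congr 1
    ext
    simp [hv.ne']
  rw [stdNormalCDF, cdf_eq_real, ← hmap, map_measureReal_apply (by fun_prop) measurableSet_Iic]
  congr 1
  ext x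
  simp [div_le_div_iff_of_pos_right hsv]

lemma integral_stdNormalCDF_sub_gaussianReal (v : NNReal) (κ : ℝ) :
    ∫ w, stdNormalCDF (κ - w) ∂(gaussianReal 0 v) = stdNormalCDF (κ / Real.sqrt (1 + v)) := by
  have hconv : (gaussianReal 0 v ∗ gaussianReal 0 1) (Set.Iic κ) =
      ∫⁻ w, ENNReal.ofReal (stdNormalCDF (κ - w)) ∂(gaussianReal 0 v) := by
    rw [Measure.conv, Measure.map_apply (by fun_prop) measurableSet_Iic,
      Measure.prod_apply (measurableSet_Iic.preimage (by fun_prop))]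
    congr 1 with w
    rw [stdNormalCDF, ofReal_cdf]
    congr 1
    ext x
    simp [le_sub_iff_add_le']
  rw [integral_eq_lintegral_of_nonneg_ae (ae_of_all _ fun w => (stdNormalCDF_pos _).le)
    (by fun_prop : Continuous fun w => stdNormalCDF (κ - w)).aestronglyMeasurable, ← hconv,
    gaussianReal_conv_gaussianReal, zero_add, ← measureReal_def,
    gaussianReal_real_Iic (by positivity)]
  simp [add_comm]

end NormalCDF

/-! ### Standard normal vectors -/

section StdNormalVector

variable {ι : Type*} [Fintype ι]

attribute [fun_prop] Continuous.dotProduct Continuous.matrix_mulVec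

/-- The law of a vector of independent standard normal variables. -/
abbrev stdNormalVector (ι : Type*) [Fintype ι] : Measure (ι → ℝ) :=
  Measure.pi fun _ : ι => gaussianReal 0 1

lemma prod_gaussianPDFReal (z : ι → ℝ) :
    ∏ i, gaussianPDFReal 0 1 (z i) =
      (Real.sqrt (2 * Real.pi))⁻¹ ^ Fintype.card ι * Real.exp (-(z ⬝ᵥ z) / 2) := by
  simp only [gaussianPDFReal, Finset.prod_mul_distrib, ← Real.exp_sum]
  simp [dotProduct, Finset.sum_div, neg_div, ← sq]

lemma stdNormalVector_eq_withDensity :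
    stdNormalVector ι = (volume : Measure (ι → ℝ)).withDensity fun z =>
      ENNReal.ofReal ((Real.sqrt (2 * Real.pi))⁻¹ ^ Fintype.card ι * Real.exp (-(z ⬝ᵥ z) / 2)) := by
  refine Measure.pi_eq fun s hs => ?_
  have hinteg : Integrable (fun z : ι → ℝ => ∏ i, gaussianPDFReal 0 1 (z i)) :=
    Integrable.fintype_prod (f := fun (_ : ι) => gaussianPDFReal 0 1)
      fun _ => integrable_gaussianPDFReal 0 1
  simp_rw [← prod_gaussianPDFReal]
  rw [withDensity_apply _ (MeasurableSet.univ_pi hs),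
    ← ofReal_integral_eq_lintegral_ofReal hinteg.integrableOn
      (ae_of_all _ fun z => Finset.prod_nonneg fun i _ => gaussianPDFReal_nonneg _ _ _),
    volume_pi, Measure.restrict_pi_pi,
    integral_fintype_prod_eq_prod (fun _ => gaussianPDFReal 0 1),
    ENNReal.ofReal_prod_of_nonneg
      fun i _ => integral_nonneg fun t => gaussianPDFReal_nonneg _ _ _]
  exact Finset.prod_congr rfl fun i _ => (gaussianReal_apply_eq_integral _ one_ne_zero _).symm

lemma integral_exp_neg_smul {F : Type*} [NormedAddCommGroup F] [NormedSpace ℝ F]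
    (f : (ι → ℝ) → F) :
    ∫ z, Real.exp (-(z ⬝ᵥ z) / 2) • f z =
      Real.sqrt (2 * Real.pi) ^ Fintype.card ι • ∫ z, f z ∂(stdNormalVector ι) := by
  rw [stdNormalVector_eq_withDensity, integral_withDensity_eq_integral_toReal_smul
    (by fun_prop) (by simp), ← integral_smul]
  congr 1 with z
  rw [ENNReal.toReal_ofReal (by positivity), smul_smul, inv_pow,
    mul_inv_cancel_left₀ (by positivity)]

lemma integrable_exp_neg_smul_iff {F : Type*} [NormedAddCommGroup F] [NormedSpace ℝ F]
    {f : (ι → ℝ) → F} :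
    Integrable (fun z => Real.exp (-(z ⬝ᵥ z) / 2) • f z) ↔
      Integrable f (stdNormalVector ι) := by
  rw [stdNormalVector_eq_withDensity,
    integrable_withDensity_iff_integrable_smul' (by fun_prop) (by simp)]
  simp_rw [ENNReal.toReal_ofReal (by positivity :
    0 ≤ (Real.sqrt (2 * Real.pi))⁻¹ ^ Fintype.card ι * Real.exp (-(_ ⬝ᵥ _) / 2)), ← smul_smul]
  rw [integrable_fun_smul_iff (by positivity)]

lemma integrable_id_stdNormalVector : Integrable (fun z : ι → ℝ => z) (stdNormalVector ι) :=
  Integrable.of_eval fun _ => integrable_eval (memLp_one_iff_integrable.1 (memLp_id_gaussianReal 1))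

lemma stdNormalVector_map_dotProduct (a : ι → ℝ) :
    (stdNormalVector ι).map (fun z => a ⬝ᵥ z) = gaussianReal 0 (a ⬝ᵥ a).toNNReal := by
  have h := IsGaussian.map_eq_gaussianReal (μ := stdGaussian (EuclideanSpace ℝ ι))
    (innerSL ℝ (WithLp.toLp 2 a))
  rw [integral_strongDual_stdGaussian, variance_dual_stdGaussian, ← map_pi_eq_stdGaussian,
    Measure.map_map (by fun_prop) (by fun_prop)] at h
  convert h using 2
  · ext z
    simp [PiLp.inner_apply, dotProduct, mul_comm]
  · simp [EuclideanSpace.norm_sq_eq, dotProduct, ← sq]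

lemma integral_stdNormalCDF_add_dotProduct (κ : ℝ) (a : ι → ℝ) :
    ∫ z, stdNormalCDF (κ + a ⬝ᵥ z) ∂(stdNormalVector ι) =
      stdNormalCDF (κ / Real.sqrt (1 + a ⬝ᵥ a)) := by
  have h := integral_stdNormalCDF_sub_gaussianReal (-a ⬝ᵥ -a).toNNReal κ
  rw [← stdNormalVector_map_dotProduct,
    integral_map (by fun_prop : Continuous fun z => -a ⬝ᵥ z).aemeasurable
      (by fun_prop : Continuous fun w => stdNormalCDF (κ - w)).aestronglyMeasurable,
    Real.coe_toNNReal _ (by simpa using dotProduct_star_self_nonneg a)] at h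
  simpa using h

lemma integrable_stdNormalCDF_add_dotProduct (κ : ℝ) (a : ι → ℝ) :
    Integrable (fun z => stdNormalCDF (κ + a ⬝ᵥ z)) (stdNormalVector ι) :=
  .of_bound (by fun_prop : Continuous _).aestronglyMeasurable 1
    (ae_of_all _ fun _ => norm_stdNormalCDF_le_one _)

lemma integrable_gaussianPDFReal_add_dotProduct (κ : ℝ) (a : ι → ℝ) :
    Integrable (fun z => gaussianPDFReal 0 1 (κ + a ⬝ᵥ z)) (stdNormalVector ι) :=
  .of_bound (by fun_prop : Continuous _).aestronglyMeasurable _ <| ae_of_all _ fun z => by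
    rw [Real.norm_of_nonneg (gaussianPDFReal_nonneg _ _ _)]
    exact gaussianPDFReal_le 0 1 _

lemma integral_gaussianPDFReal_add_dotProduct (κ : ℝ) (a : ι → ℝ) :
    ∫ z, gaussianPDFReal 0 1 (κ + a ⬝ᵥ z) ∂(stdNormalVector ι) =
      gaussianPDFReal 0 1 (κ / Real.sqrt (1 + a ⬝ᵥ a)) / Real.sqrt (1 + a ⬝ᵥ a) := by
  -- Both sides are the derivative in `κ` of `∫ Φ(κ + aᵀz)`.
  have hderiv : HasDerivAt (fun κ => ∫ z, stdNormalCDF (κ + a ⬝ᵥ z) ∂(stdNormalVector ι))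
      (∫ z, gaussianPDFReal 0 1 (κ + a ⬝ᵥ z) ∂(stdNormalVector ι)) κ :=
    (hasDerivAt_integral_of_dominated_loc_of_deriv_le
      (bound := fun _ => (Real.sqrt (2 * Real.pi * (1 : NNReal)))⁻¹) Filter.univ_mem
      (.of_forall fun κ => (integrable_stdNormalCDF_add_dotProduct κ a).aestronglyMeasurable)
      (integrable_stdNormalCDF_add_dotProduct κ a)
      (integrable_gaussianPDFReal_add_dotProduct κ a).aestronglyMeasurable
      (ae_of_all _ fun z κ _ => by
        rw [Real.norm_of_nonneg (gaussianPDFReal_nonneg _ _ _)]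
        exact gaussianPDFReal_le 0 1 _)
      (integrable_const _)
      (ae_of_all _ fun z κ _ => (hasDerivAt_stdNormalCDF _).comp_add_const κ (a ⬝ᵥ z))).2
  simp_rw [integral_stdNormalCDF_add_dotProduct] at hderiv
  rw [hderiv.unique ((hasDerivAt_stdNormalCDF _).comp κ ((hasDerivAt_id κ).div_const _)),
    mul_one_div]

lemma hasLineDerivAt_exp_neg_dotProduct_self (v z : ι → ℝ) :
    HasLineDerivAt ℝ (fun z => Real.exp (-(z ⬝ᵥ z) / 2))
      (-(Real.exp (-(z ⬝ᵥ z) / 2) * (v ⬝ᵥ z))) z v := by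
  have hquad : HasDerivAt (fun t : ℝ => -((z + t • v) ⬝ᵥ (z + t • v)) / 2) (-(v ⬝ᵥ z)) 0 := by
    have hexpand : (fun t : ℝ => -((z + t • v) ⬝ᵥ (z + t • v)) / 2) =
        fun t => -(z ⬝ᵥ z) / 2 + t * (-(v ⬝ᵥ z)) + t ^ 2 * (-(v ⬝ᵥ v) / 2) := by
      ext t
      simp only [add_dotProduct, dotProduct_add, smul_dotProduct, dotProduct_smul, smul_eq_mul,
        dotProduct_comm z v]
      ring
    rw [hexpand]
    simpa using (((hasDerivAt_id (0 : ℝ)).mul_const (-(v ⬝ᵥ z))).const_add (-(z ⬝ᵥ z) / 2)).fun_add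
      ((hasDerivAt_pow 2 (0 : ℝ)).mul_const (-(v ⬝ᵥ v) / 2))
  simpa [HasLineDerivAt] using hquad.exp

/-- Stein's identity. -/
lemma integral_dotProduct_mul_stdNormalVector {f f' : (ι → ℝ) → ℝ} {v : ι → ℝ}
    (hf : ∀ z, HasLineDerivAt ℝ f (f' z) z v) (hfi : Integrable f (stdNormalVector ι))
    (hf'i : Integrable f' (stdNormalVector ι))
    (hvf : Integrable (fun z => v ⬝ᵥ z * f z) (stdNormalVector ι)) :
    ∫ z, v ⬝ᵥ z * f z ∂(stdNormalVector ι) = ∫ z, f' z ∂(stdNormalVector ι) := by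
  have hparts := integral_bilinear_hasLineDerivAt_right_eq_neg_left_of_integrable
    (μ := (volume : Measure (ι → ℝ))) (B := ContinuousLinearMap.mul ℝ ℝ)
    (f := fun z => Real.exp (-(z ⬝ᵥ z) / 2)) (g := f) (g' := f')
    (by simpa [mul_assoc] using (integrable_exp_neg_smul_iff.2 hvf).neg)
    (integrable_exp_neg_smul_iff.2 hf'i) (integrable_exp_neg_smul_iff.2 hfi)
    (fun z _ => hasLineDerivAt_exp_neg_dotProduct_self v z) (fun z _ => hf z)
  simp only [ContinuousLinearMap.mul_apply', neg_mul, integral_neg, neg_neg, mul_assoc] at hparts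
  simp_rw [← smul_eq_mul (Real.exp _)] at hparts
  rw [integral_exp_neg_smul, integral_exp_neg_smul] at hparts
  exact (smul_right_injective ℝ (by positivity) hparts).symm

lemma integrable_stdNormalCDF_smul_id (κ : ℝ) (a : ι → ℝ) :
    Integrable (fun z => stdNormalCDF (κ + a ⬝ᵥ z) • z) (stdNormalVector ι) :=
  integrable_id_stdNormalVector.bdd_smul 1
    (integrable_stdNormalCDF_add_dotProduct κ a).aestronglyMeasurable
    (ae_of_all _ fun _ => norm_stdNormalCDF_le_one _)

lemma hasLineDerivAt_stdNormalCDF_add_dotProduct (κ : ℝ) (a v z : ι → ℝ) :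
    HasLineDerivAt ℝ (fun z => stdNormalCDF (κ + a ⬝ᵥ z))
      (gaussianPDFReal 0 1 (κ + a ⬝ᵥ z) * (a ⬝ᵥ v)) z v := by
  have hlin : HasDerivAt (fun t : ℝ => κ + a ⬝ᵥ (z + t • v)) (a ⬝ᵥ v) 0 := by
    simpa [dotProduct_add, add_assoc] using
      (((hasDerivAt_id (0 : ℝ)).mul_const (a ⬝ᵥ v)).const_add (a ⬝ᵥ z)).const_add κ
  have hCDF := hasDerivAt_stdNormalCDF (κ + a ⬝ᵥ (z + (0 : ℝ) • v))
  simpa only [HasLineDerivAt, Function.comp_def, zero_smul, add_zero] using hCDF.comp (0 : ℝ) hlin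

lemma integral_stdNormalCDF_smul_id (κ : ℝ) (a : ι → ℝ) :
    ∫ z, stdNormalCDF (κ + a ⬝ᵥ z) • z ∂(stdNormalVector ι) =
      (gaussianPDFReal 0 1 (κ / Real.sqrt (1 + a ⬝ᵥ a)) / Real.sqrt (1 + a ⬝ᵥ a)) • a := by
  classical
  ext i
  have hinteg := integrable_stdNormalCDF_smul_id κ a
  have hstein := integral_dotProduct_mul_stdNormalVector
    (hasLineDerivAt_stdNormalCDF_add_dotProduct κ a (Pi.single i 1))
    (integrable_stdNormalCDF_add_dotProduct κ a)
    ((integrable_gaussianPDFReal_add_dotProduct κ a).mul_const _)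
    (by simpa [mul_comm] using hinteg.eval i)
  rw [eval_integral hinteg.eval]
  simpa [mul_comm, integral_const_mul, integral_gaussianPDFReal_add_dotProduct] using hstein

end StdNormalVector

/-! ### Inverse square roots, block matrices and completing the square -/

section Matrices

variable {ι κ : Type*} [Fintype ι] [Fintype κ]

lemma posSemidef_invSqrtM [DecidableEq ι] (S : Matrix ι ι ℝ) : (invSqrtM S).PosSemidef :=
  nonneg_iff_posSemidef.1 (CFC.sqrt_nonneg _)

lemma transpose_invSqrtM [DecidableEq ι] (S : Matrix ι ι ℝ) : (invSqrtM S)ᵀ = invSqrtM S := by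
  simpa using (posSemidef_invSqrtM S).isHermitian.eq

lemma invSqrtM_mulVec_dotProduct [DecidableEq ι] (S : Matrix ι ι ℝ) (x y : ι → ℝ) :
    invSqrtM S *ᵥ x ⬝ᵥ y = x ⬝ᵥ invSqrtM S *ᵥ y := by
  conv_rhs => rw [dotProduct_mulVec, ← mulVec_transpose, transpose_invSqrtM]

lemma invSqrtM_mul_invSqrtM [DecidableEq ι] {S : Matrix ι ι ℝ} (hS : S.PosDef) :
    invSqrtM S * invSqrtM S = S⁻¹ :=
  CFC.sqrt_mul_sqrt_self S⁻¹ (nonneg_iff_posSemidef.2 hS.inv.posSemidef)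

lemma invSqrtM_mul_mul_invSqrtM [DecidableEq ι] {S : Matrix ι ι ℝ} (hS : S.PosDef) :
    invSqrtM S * S * invSqrtM S = 1 := by
  have h : invSqrtM S * (invSqrtM S * S) = 1 := by
    rw [← mul_assoc, invSqrtM_mul_invSqrtM hS, nonsing_inv_mul _ hS.det_pos.ne'.isUnit]
  exact mul_eq_one_comm.1 h

lemma det_invSqrtM [DecidableEq ι] {S : Matrix ι ι ℝ} (hS : S.PosDef) :
    (invSqrtM S).det = (Real.sqrt S.det)⁻¹ := by
  rw [← Real.sqrt_inv, eq_comm, Real.sqrt_eq_iff_mul_self_eq (inv_nonneg.2 hS.det_pos.le)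
    (posSemidef_invSqrtM S).det_nonneg, ← det_mul, invSqrtM_mul_invSqrtM hS, det_nonsing_inv,
    Ring.inverse_eq_inv']

lemma posSemidef_fromBlocks_diagonal {ι κ : Type*} [Finite ι] [Finite κ] {A : Matrix ι ι ℝ}
    {B : Matrix κ κ ℝ} (hA : A.PosSemidef) (hB : B.PosSemidef) :
    (fromBlocks A 0 0 B).PosSemidef := by
  cases nonempty_fintype ι
  cases nonempty_fintype κ
  refine .of_dotProduct_mulVec_nonneg (hA.isHermitian.fromBlocks (by simp) hB.isHermitian)
    fun x => ?_
  rw [← Sum.elim_comp_inl_inr x, star_trivial, fromBlocks_mulVec, sumElim_dotProduct_sumElim]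
  simpa using add_nonneg (hA.dotProduct_mulVec_nonneg (x ∘ Sum.inl))
    (hB.dotProduct_mulVec_nonneg (x ∘ Sum.inr))

lemma posDef_fromBlocks_diagonal {ι κ : Type*} [Finite ι] [Finite κ] {A : Matrix ι ι ℝ}
    {B : Matrix κ κ ℝ} (hA : A.PosDef) (hB : B.PosDef) : (fromBlocks A 0 0 B).PosDef := by
  classical
  cases nonempty_fintype ι
  cases nonempty_fintype κ
  refine (posSemidef_fromBlocks_diagonal hA.posSemidef hB.posSemidef).posDef_iff_isUnit.2 ?_
  exact isUnit_fromBlocks_zero₂₁.2 ⟨hA.isUnit, hB.isUnit⟩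

variable [DecidableEq ι] [DecidableEq κ]

lemma inv_fromBlocks_diagonal {A : Matrix ι ι ℝ} {B : Matrix κ κ ℝ} (hA : A.PosDef)
    (hB : B.PosDef) : (fromBlocks A 0 0 B)⁻¹ = fromBlocks A⁻¹ 0 0 B⁻¹ := by
  rw [inv_fromBlocks_zero₂₁_of_isUnit_iff _ _ _ (iff_of_true hA.isUnit hB.isUnit)]
  simp

lemma invSqrtM_fromBlocks_diagonal {A : Matrix ι ι ℝ} {B : Matrix κ κ ℝ} (hA : A.PosDef)
    (hB : B.PosDef) :
    invSqrtM (fromBlocks A 0 0 B) = fromBlocks (invSqrtM A) 0 0 (invSqrtM B) := by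
  refine CFC.sqrt_unique ?_ (nonneg_iff_posSemidef.2
    (posSemidef_fromBlocks_diagonal (posSemidef_invSqrtM A) (posSemidef_invSqrtM B)))
  rw [fromBlocks_multiply, inv_fromBlocks_diagonal hA hB]
  simp [invSqrtM_mul_invSqrtM hA, invSqrtM_mul_invSqrtM hB]

/-- The push-through identity. -/
lemma inv_add_mul_mul_mul_inv {D : Matrix ι ι ℝ} {Sig : Matrix κ κ ℝ} {Z : Matrix κ ι ℝ}
    (hD : IsUnit D.det) (hSig : IsUnit Sig.det) (hPsi : IsUnit (Sig + Z * D * Zᵀ).det) :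
    (D⁻¹ + Zᵀ * Sig⁻¹ * Z) * (D * Zᵀ * (Sig + Z * D * Zᵀ)⁻¹) = Zᵀ * Sig⁻¹ := by
  have hfactor : (D⁻¹ + Zᵀ * Sig⁻¹ * Z) * (D * Zᵀ) = Zᵀ * Sig⁻¹ * (Sig + Z * D * Zᵀ) := by
    rw [Matrix.add_mul, Matrix.mul_add, ← Matrix.mul_assoc D⁻¹, nonsing_inv_mul _ hD,
      Matrix.mul_assoc Zᵀ Sig⁻¹ Sig, nonsing_inv_mul _ hSig, Matrix.one_mul, Matrix.mul_one]
    simp only [Matrix.mul_assoc]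
  rw [← Matrix.mul_assoc, hfactor, Matrix.mul_assoc, mul_nonsing_inv _ hPsi, Matrix.mul_one]

end Matrices

section CompletingSquare

variable {ι κ : Type*} [Fintype ι] [Fintype κ]

lemma dotProduct_mulVec_comm_of_isHermitian {A : Matrix ι ι ℝ} (hA : A.IsHermitian)
    (x y : ι → ℝ) : x ⬝ᵥ A *ᵥ y = y ⬝ᵥ A *ᵥ x := by
  have hAt : Aᵀ = A := by simpa using hA.eq
  rw [dotProduct_mulVec, ← mulVec_transpose, hAt, dotProduct_comm]

lemma quadratic_add_quadratic_eq {A : Matrix ι ι ℝ} {B : Matrix κ κ ℝ} (hA : A.IsHermitian)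
    (hB : B.IsHermitian) (Z : Matrix κ ι ℝ) (d : κ → ℝ) (x r : ι → ℝ)
    (hr : (A + Zᵀ * B * Z) *ᵥ r = (Zᵀ * B) *ᵥ d) :
    x ⬝ᵥ A *ᵥ x + (d - Z *ᵥ x) ⬝ᵥ B *ᵥ (d - Z *ᵥ x) =
      (x - r) ⬝ᵥ (A + Zᵀ * B * Z) *ᵥ (x - r) +
        (d ⬝ᵥ B *ᵥ d - r ⬝ᵥ (A + Zᵀ * B * Z) *ᵥ r) := by
  have hL : (A + Zᵀ * B * Z).IsHermitian := by
    simpa using hA.add (isHermitian_conjTranspose_mul_mul Z hB)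
  have hZ (w : κ → ℝ) : Z *ᵥ x ⬝ᵥ w = x ⬝ᵥ Zᵀ *ᵥ w := by
    rw [mulVec_transpose, dotProduct_comm, dotProduct_mulVec, dotProduct_comm]
  have hquad : x ⬝ᵥ (A + Zᵀ * B * Z) *ᵥ x = x ⬝ᵥ A *ᵥ x + Z *ᵥ x ⬝ᵥ B *ᵥ (Z *ᵥ x) := by
    rw [add_mulVec, dotProduct_add, hZ, mulVec_mulVec, mulVec_mulVec]
  have hcross : Z *ᵥ x ⬝ᵥ B *ᵥ d = x ⬝ᵥ (A + Zᵀ * B * Z) *ᵥ r := by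
    rw [hr, hZ, mulVec_mulVec]
  simp only [mulVec_sub, sub_dotProduct, dotProduct_sub]
  rw [dotProduct_mulVec_comm_of_isHermitian hL r x, hquad, ← hcross,
    dotProduct_mulVec_comm_of_isHermitian hB d (Z *ᵥ x)]
  ring

end CompletingSquare

/-! ### Linear changes of variables -/

section ChangeOfVariables

variable {ι : Type*} [Fintype ι] [DecidableEq ι] {M : Matrix ι ι ℝ}

lemma map_mulVec_volume (hM : M.det ≠ 0) :
    (volume : Measure (ι → ℝ)).map (M *ᵥ ·) = ENNReal.ofReal |M.det⁻¹| • volume :=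
  Real.map_matrix_volume_pi_eq_smul_volume_pi hM

lemma measurableEmbedding_mulVec (hM : M.det ≠ 0) :
    MeasurableEmbedding fun z : ι → ℝ => M *ᵥ z :=
  (Measurable.measurableEmbedding (by fun_prop : Continuous fun z => M *ᵥ z).measurable
    (mulVec_injective_of_isUnit ((isUnit_iff_isUnit_det M).2 hM.isUnit)))

lemma lintegral_eq_lintegral_comp_mulVec (hM : M.det ≠ 0) (g : (ι → ℝ) → ℝ≥0∞) :
    ∫⁻ x, g x = ENNReal.ofReal |M.det| * ∫⁻ z, g (M *ᵥ z) := by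
  rw [← (measurableEmbedding_mulVec hM).lintegral_map, map_mulVec_volume hM,
    lintegral_smul_measure, smul_eq_mul, ← mul_assoc, ← ENNReal.ofReal_mul (abs_nonneg _),
    ← abs_mul, mul_inv_cancel₀ hM, abs_one, ENNReal.ofReal_one, one_mul]

variable {F : Type*} [NormedAddCommGroup F]

lemma integrable_comp_mulVec_iff (hM : M.det ≠ 0) {g : (ι → ℝ) → F} :
    Integrable (fun z => g (M *ᵥ z)) ↔ Integrable g := by
  have hdet : ENNReal.ofReal |M.det⁻¹| ≠ 0 :=
    (ENNReal.ofReal_pos.2 (abs_pos.2 (inv_ne_zero hM))).ne'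
  rw [← integrable_smul_measure (f := g) hdet ENNReal.ofReal_ne_top, ← map_mulVec_volume hM,
    (measurableEmbedding_mulVec hM).integrable_map_iff]
  rfl

lemma integral_eq_integral_comp_mulVec [NormedSpace ℝ F] (hM : M.det ≠ 0) (g : (ι → ℝ) → F) :
    ∫ x, g x = |M.det| • ∫ z, g (M *ᵥ z) := by
  rw [← (measurableEmbedding_mulVec hM).integral_map, map_mulVec_volume hM,
    integral_smul_measure, ENNReal.toReal_ofReal (abs_nonneg _), smul_smul, ← abs_mul,
    mul_inv_cancel₀ hM, abs_one, one_smul]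

end ChangeOfVariables

/-! ### Extended skew-normal densities -/

/-- The unnormalised extended skew-normal density `exp(-xᵀ L x / 2) Φ(κ + ζᵀ x)` with precision
matrix `L`, shift `κ` and slope `ζ`. The densities of the random effects before and after
conditioning on the response are both of this form. -/
def skewGaussian {ι : Type*} [Fintype ι] (L : Matrix ι ι ℝ) (κ : ℝ) (ζ x : ι → ℝ) : ℝ :=
  Real.exp (-(x ⬝ᵥ L *ᵥ x) / 2) * stdNormalCDF (κ + ζ ⬝ᵥ x)

section SkewGaussian

variable {ι κ : Type*} [Fintype ι] [Fintype κ]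

lemma skewGaussian_nonneg (L : Matrix ι ι ℝ) (k : ℝ) (ζ x : ι → ℝ) : 0 ≤ skewGaussian L k ζ x :=
  mul_nonneg (Real.exp_pos _).le (stdNormalCDF_pos _).le

lemma skewGaussian_mulVec (L : Matrix κ κ ℝ) (M : Matrix κ ι ℝ) (k : ℝ) (ζ : κ → ℝ) (z : ι → ℝ) :
    skewGaussian L k ζ (M *ᵥ z) = skewGaussian (Mᵀ * L * M) k (Mᵀ *ᵥ ζ) z := by
  have hM (w : κ → ℝ) : w ⬝ᵥ M *ᵥ z = Mᵀ *ᵥ w ⬝ᵥ z := by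
    rw [mulVec_transpose, dotProduct_mulVec]
  rw [skewGaussian, skewGaussian, hM, dotProduct_comm, hM, mulVec_mulVec, mulVec_mulVec,
    dotProduct_comm]

/-- The vector `r` is the conditional mean of `x` given the response in the symmetric case `ζ = 0`;
the equation `hr` says so without inverting the precision matrix. -/
lemma skewGaussian_fromBlocks_sumElim_sub {A : Matrix ι ι ℝ} {B : Matrix κ κ ℝ}
    (hA : A.IsHermitian) (hB : B.IsHermitian) (k : ℝ) (ζ : ι → ℝ) (Z : Matrix κ ι ℝ) (d : κ → ℝ)
    (x r : ι → ℝ) (hr : (A + Zᵀ * B * Z) *ᵥ r = (Zᵀ * B) *ᵥ d) :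
    skewGaussian (fromBlocks A 0 0 B) k (Sum.elim ζ 0) (Sum.elim x (d - Z *ᵥ x)) =
      Real.exp (-(d ⬝ᵥ B *ᵥ d - r ⬝ᵥ (A + Zᵀ * B * Z) *ᵥ r) / 2) *
        skewGaussian (A + Zᵀ * B * Z) (k + ζ ⬝ᵥ r) ζ (x - r) := by
  have hquad := quadratic_add_quadratic_eq hA hB Z d x r hr
  simp only [skewGaussian, fromBlocks_mulVec, sumElim_dotProduct_sumElim, Sum.elim_comp_inl,
    Sum.elim_comp_inr, zero_mulVec, add_zero, zero_add, zero_dotProduct]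
  rw [hquad, ← mul_assoc, ← Real.exp_add, dotProduct_sub]
  congr 2 <;> ring

variable [DecidableEq ι]

lemma skewGaussian_one (k : ℝ) (a z : ι → ℝ) :
    skewGaussian 1 k a z = Real.exp (-(z ⬝ᵥ z) / 2) • stdNormalCDF (k + a ⬝ᵥ z) := by
  rw [skewGaussian, one_mulVec, smul_eq_mul]

variable {L : Matrix ι ι ℝ}

lemma det_invSqrtM_ne_zero (hL : L.PosDef) : (invSqrtM L).det ≠ 0 := by
  rw [det_invSqrtM hL]
  exact inv_ne_zero (Real.sqrt_ne_zero'.2 hL.det_pos)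

lemma skewGaussian_invSqrtM_mulVec (hL : L.PosDef) (k : ℝ) (ζ z : ι → ℝ) :
    skewGaussian L k ζ (invSqrtM L *ᵥ z) = skewGaussian 1 k (invSqrtM L *ᵥ ζ) z := by
  rw [skewGaussian_mulVec, transpose_invSqrtM, invSqrtM_mul_mul_invSqrtM hL]

lemma invSqrtM_mulVec_dotProduct_self (hL : L.PosDef) (ζ : ι → ℝ) :
    invSqrtM L *ᵥ ζ ⬝ᵥ invSqrtM L *ᵥ ζ = ζ ⬝ᵥ L⁻¹ *ᵥ ζ := by
  rw [invSqrtM_mulVec_dotProduct, mulVec_mulVec, invSqrtM_mul_invSqrtM hL]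

lemma integrable_skewGaussian {ι : Type*} [Fintype ι] {L : Matrix ι ι ℝ} (hL : L.PosDef)
    (k : ℝ) (ζ : ι → ℝ) :
    Integrable (skewGaussian L k ζ) := by
  classical
  rw [← integrable_comp_mulVec_iff (det_invSqrtM_ne_zero hL)]
  simp_rw [skewGaussian_invSqrtM_mulVec hL, skewGaussian_one]
  exact integrable_exp_neg_smul_iff.2 (integrable_stdNormalCDF_add_dotProduct _ _)

lemma integrable_skewGaussian_smul_id {ι : Type*} [Fintype ι] {L : Matrix ι ι ℝ} (hL : L.PosDef)
    (k : ℝ) (ζ : ι → ℝ) :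
    Integrable fun x => skewGaussian L k ζ x • x := by
  classical
  rw [← integrable_comp_mulVec_iff (det_invSqrtM_ne_zero hL)]
  simp_rw [skewGaussian_invSqrtM_mulVec hL, skewGaussian_one, ← mulVec_smul, smul_assoc]
  exact (mulVecLin (invSqrtM L)).toContinuousLinearMap.integrable_comp
    (integrable_exp_neg_smul_iff.2 (integrable_stdNormalCDF_smul_id _ _))

lemma integral_skewGaussian (hL : L.PosDef) (k : ℝ) (ζ : ι → ℝ) :
    ∫ x, skewGaussian L k ζ x =
      |(invSqrtM L).det| * (Real.sqrt (2 * Real.pi) ^ Fintype.card ι *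
        stdNormalCDF (k / Real.sqrt (1 + ζ ⬝ᵥ L⁻¹ *ᵥ ζ))) := by
  rw [integral_eq_integral_comp_mulVec (det_invSqrtM_ne_zero hL)]
  simp_rw [skewGaussian_invSqrtM_mulVec hL, skewGaussian_one]
  rw [integral_exp_neg_smul, integral_stdNormalCDF_add_dotProduct,
    invSqrtM_mulVec_dotProduct_self hL, smul_eq_mul, smul_eq_mul]

lemma integral_skewGaussian_smul_id (hL : L.PosDef) (k : ℝ) (ζ : ι → ℝ) :
    ∫ x, skewGaussian L k ζ x • x =
      (∫ x, skewGaussian L k ζ x) •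
        ((WPhi (k / Real.sqrt (1 + ζ ⬝ᵥ L⁻¹ *ᵥ ζ)) / Real.sqrt (1 + ζ ⬝ᵥ L⁻¹ *ᵥ ζ)) •
          L⁻¹ *ᵥ ζ) := by
  rw [integral_skewGaussian hL, integral_eq_integral_comp_mulVec (det_invSqrtM_ne_zero hL)]
  simp_rw [skewGaussian_invSqrtM_mulVec hL, skewGaussian_one, ← mulVec_smul, smul_assoc]
  have hcomm := (mulVecLin (invSqrtM L)).toContinuousLinearMap.integral_comp_comm
    (integrable_exp_neg_smul_iff.2 (integrable_stdNormalCDF_smul_id k (invSqrtM L *ᵥ ζ)))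
  simp only [LinearMap.coe_toContinuousLinearMap', mulVecLin_apply] at hcomm
  rw [hcomm, integral_exp_neg_smul, integral_stdNormalCDF_smul_id, mulVec_smul, mulVec_smul,
    mulVec_mulVec, invSqrtM_mul_invSqrtM hL, invSqrtM_mulVec_dotProduct_self hL, WPhi]
  have hcdf := (stdNormalCDF_pos (k / Real.sqrt (1 + ζ ⬝ᵥ L⁻¹ *ᵥ ζ))).ne'
  simp only [smul_smul, mulVec_smul]
  congr 1
  field_simp

lemma integral_skewGaussian_sub_smul_id (hL : L.PosDef) (k : ℝ) (ζ m : ι → ℝ) :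
    ∫ x, skewGaussian L k ζ (x - m) • x =
      (∫ x, skewGaussian L k ζ (x - m)) •
        (m + (WPhi (k / Real.sqrt (1 + ζ ⬝ᵥ L⁻¹ *ᵥ ζ)) / Real.sqrt (1 + ζ ⬝ᵥ L⁻¹ *ᵥ ζ)) •
          L⁻¹ *ᵥ ζ) := by
  rw [integral_sub_right_eq_self (skewGaussian L k ζ),
    ← integral_add_right_eq_self (fun x => skewGaussian L k ζ (x - m) • x) m]
  simp_rw [add_sub_cancel_right, smul_add]
  rw [integral_add (integrable_skewGaussian_smul_id hL k ζ)
    ((integrable_skewGaussian hL k ζ).smul_const m), integral_skewGaussian_smul_id hL,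
    integral_smul_const, add_comm]

end SkewGaussian

/-! ### Standardizing a scale mixture of skew-normal laws -/

section SMSN

variable {ι : Type*} [Fintype ι] [DecidableEq ι]

lemma inv_inv_smul_of_isUnit_det {S : Matrix ι ι ℝ} (hS : IsUnit S.det) (u : ℝ) :
    (u⁻¹ • S)⁻¹ = u • S⁻¹ := by
  rcases eq_or_ne u 0 with rfl | hu
  · simp
  · have := invertibleOfNonzero (inv_ne_zero hu)
    rw [inv_smul _ u⁻¹ hS, invOf_eq_inv, inv_inv]

/-- The constant factor of the density `scaledSkewNormalPDF μ S lam u`. -/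
def scaledSkewNormalConst (S : Matrix ι ι ℝ) (u : ℝ) : ℝ :=
  2 * (Real.sqrt ((2 * Real.pi) ^ Fintype.card ι * (u⁻¹ • S).det))⁻¹

lemma scaledSkewNormalPDF_eq {S : Matrix ι ι ℝ} (hS : S.PosDef) (μ lam : ι → ℝ) (u : ℝ)
    (w : ι → ℝ) :
    scaledSkewNormalPDF μ S lam u w =
      scaledSkewNormalConst S u *
        skewGaussian (u • S⁻¹) 0 (Real.sqrt u • invSqrtM S *ᵥ lam) (w - μ) := by
  rw [scaledSkewNormalPDF, normalPDF, scaledSkewNormalConst, skewGaussian,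
    inv_inv_smul_of_isUnit_det hS.det_pos.ne'.isUnit, smul_dotProduct,
    ← invSqrtM_mulVec_dotProduct, zero_add, smul_eq_mul]
  ring

lemma scaledSkewNormalConst_nonneg (S : Matrix ι ι ℝ) (u : ℝ) : 0 ≤ scaledSkewNormalConst S u :=
  mul_nonneg zero_le_two (inv_nonneg.2 (Real.sqrt_nonneg _))

lemma scaledSkewNormalPDF_nonneg {S : Matrix ι ι ℝ} (hS : S.PosDef) (μ lam : ι → ℝ) (u : ℝ)
    (w : ι → ℝ) : 0 ≤ scaledSkewNormalPDF μ S lam u w := by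
  rw [scaledSkewNormalPDF_eq hS]
  exact mul_nonneg (scaledSkewNormalConst_nonneg S u) (skewGaussian_nonneg _ _ _ _)

lemma measurable_scaledSkewNormalPDF {S : Matrix ι ι ℝ} (hS : S.PosDef) (μ lam : ι → ℝ) :
    Measurable fun p : ℝ × (ι → ℝ) => scaledSkewNormalPDF μ S lam p.1 p.2 := by
  have hsub : Measurable fun p : ℝ × (ι → ℝ) => p.2 - μ := by fun_prop
  have hquad : Continuous fun x : ι → ℝ => x ⬝ᵥ S⁻¹ *ᵥ x := by fun_prop
  have hlin : Continuous fun x : ι → ℝ => invSqrtM S *ᵥ lam ⬝ᵥ x := by fun_prop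
  have hcdf := continuous_stdNormalCDF.measurable
  simp only [scaledSkewNormalPDF_eq hS, scaledSkewNormalConst, skewGaussian, det_smul, smul_mulVec,
    dotProduct_smul, smul_dotProduct, smul_eq_mul, zero_add]
  have hquad' := hquad.measurable.comp hsub
  have hlin' := hlin.measurable.comp hsub
  simp only [Function.comp_def] at hquad' hlin'
  fun_prop

/-- The density `2 φ_p(z) Φ(lamᵀ z)` of the standard skew-normal law. -/
def standardSkewNormalPDF (lam z : ι → ℝ) : ℝ :=
  2 * (Real.sqrt ((2 * Real.pi) ^ Fintype.card ι))⁻¹ * skewGaussian 1 0 lam z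

/-- The standard skew-normal law, which is the law of `U^{1/2} S^{-1/2} (W - μ)` when `W` is SMSN
with mixing factor `U`. -/
def standardSkewNormal (lam : ι → ℝ) : Measure (ι → ℝ) :=
  volume.withDensity fun z => ENNReal.ofReal (standardSkewNormalPDF lam z)

lemma scaledSkewNormalPDF_eq_standardized {S : Matrix ι ι ℝ} (hS : S.PosDef) (μ lam : ι → ℝ)
    {u : ℝ} (hu : 0 < u) (w : ι → ℝ) :
    scaledSkewNormalPDF μ S lam u w =
      |(Real.sqrt u • invSqrtM S).det| *
        standardSkewNormalPDF lam ((Real.sqrt u • invSqrtM S) *ᵥ (w - μ)) := by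
  have hsymm : (Real.sqrt u • invSqrtM S)ᵀ = Real.sqrt u • invSqrtM S := by
    rw [transpose_smul, transpose_invSqrtM]
  have hprec : Real.sqrt u • invSqrtM S * Real.sqrt u • invSqrtM S = u • S⁻¹ := by
    rw [smul_mul_smul_comm, invSqrtM_mul_invSqrtM hS, Real.mul_self_sqrt hu.le]
  have hdet : |(Real.sqrt u • invSqrtM S).det| = (Real.sqrt (u⁻¹ • S).det)⁻¹ := by
    rw [← Real.sqrt_mul_self_eq_abs, ← det_mul, hprec,
      ← inv_inv_smul_of_isUnit_det hS.det_pos.ne'.isUnit, det_nonsing_inv, Ring.inverse_eq_inv',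
      Real.sqrt_inv]
  rw [scaledSkewNormalPDF_eq hS, standardSkewNormalPDF, skewGaussian_mulVec, mul_one,
    hsymm, hprec, hdet, scaledSkewNormalConst, Real.sqrt_mul (by positivity), smul_mulVec]
  ring

lemma standardSkewNormalPDF_nonneg (lam z : ι → ℝ) : 0 ≤ standardSkewNormalPDF lam z :=
  mul_nonneg (by positivity) (skewGaussian_nonneg _ _ _ _)

lemma integrable_standardSkewNormalPDF (lam : ι → ℝ) : Integrable (standardSkewNormalPDF lam) :=
  (integrable_skewGaussian .one 0 lam).const_mul _

instance (lam : ι → ℝ) : IsFiniteMeasure (standardSkewNormal lam) :=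
  isFiniteMeasure_withDensity_ofReal (integrable_standardSkewNormalPDF lam).2

lemma integrable_id_standardSkewNormal (lam : ι → ℝ) :
    Integrable (fun z => z) (standardSkewNormal lam) := by
  rw [standardSkewNormal, integrable_withDensity_iff_integrable_smul₀'
    (integrable_standardSkewNormalPDF lam).aemeasurable.ennreal_ofReal
    (ae_of_all _ fun _ => ENNReal.ofReal_lt_top)]
  simp_rw [ENNReal.toReal_ofReal (standardSkewNormalPDF_nonneg lam _), standardSkewNormalPDF,
    mul_smul]
  exact ((integrable_skewGaussian_smul_id .one 0 lam).smul
    (Real.sqrt ((2 * Real.pi) ^ Fintype.card ι))⁻¹).smul (2 : ℝ)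

lemma lintegral_scaledSkewNormalPDF_mul {S : Matrix ι ι ℝ} (hS : S.PosDef) (μ lam : ι → ℝ) {u : ℝ}
    (hu : 0 < u) {φ : (ι → ℝ) → ℝ≥0∞} (hφ : Measurable φ) :
    ∫⁻ w, ENNReal.ofReal (scaledSkewNormalPDF μ S lam u w) *
        φ (Real.sqrt u • invSqrtM S *ᵥ (w - μ)) =
      ∫⁻ z, φ z ∂standardSkewNormal lam := by
  have hdet : (Real.sqrt u • invSqrtM S).det ≠ 0 := by
    rw [det_smul]
    exact mul_ne_zero (pow_ne_zero _ (Real.sqrt_ne_zero'.2 hu)) (det_invSqrtM_ne_zero hS)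
  symm
  rw [standardSkewNormal, lintegral_withDensity_eq_lintegral_mul₀
      (integrable_standardSkewNormalPDF lam).aemeasurable.ennreal_ofReal hφ.aemeasurable,
    lintegral_eq_lintegral_comp_mulVec hdet, ← lintegral_const_mul' _ _ ENNReal.ofReal_ne_top,
    ← lintegral_sub_right_eq_self _ μ]
  simp_rw [scaledSkewNormalPDF_eq_standardized hS μ lam hu, ENNReal.ofReal_mul (abs_nonneg _),
    mul_assoc, ← smul_mulVec, Pi.mul_apply]

end SMSN

section IsSMSN

variable {Ω ι : Type*} [MeasurableSpace Ω] [Fintype ι] [DecidableEq ι] {P : Measure Ω}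
  {U : Ω → ℝ} {W : Ω → ι → ℝ} {μ lam : ι → ℝ} {S : Matrix ι ι ℝ} {H : Measure ℝ}

lemma measurable_standardize (μ : ι → ℝ) (S : Matrix ι ι ℝ) :
    Measurable fun p : ℝ × (ι → ℝ) => Real.sqrt p.1 • invSqrtM S *ᵥ (p.2 - μ) :=
  (by fun_prop : Continuous _).measurable

lemma IsSMSN.map_standardized (h : IsSMSN P U W μ S lam H) (hU : Measurable U)
    (hW : Measurable W) (hS : S.PosDef) (hH : ∀ᵐ u ∂H, 0 < u) :
    P.map (fun ω => (U ω, Real.sqrt (U ω) • invSqrtM S *ᵥ (W ω - μ))) =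
      H.prod (standardSkewNormal lam) := by
  have hg := measurable_fst.prodMk (measurable_standardize μ S)
  have hpdf := (measurable_scaledSkewNormalPDF hS μ lam).ennreal_ofReal
  have hmap := Measure.map_map (μ := P) hg (hU.prodMk hW)
  rw [h] at hmap
  refine hmap.symm.trans (Measure.ext_of_lintegral _ fun φ hφ => ?_)
  have hφg := hφ.comp hg
  refine (lintegral_map hφ hg).trans
    ((lintegral_withDensity_eq_lintegral_mul _ hpdf hφg).trans ?_)
  rw [lintegral_prod _ (hpdf.mul hφg).aemeasurable, lintegral_prod _ hφ.aemeasurable]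
  refine lintegral_congr_ae (hH.mono fun u hu => ?_)
  exact lintegral_scaledSkewNormalPDF_mul hS μ lam hu (hφ.comp measurable_prodMk_left)

lemma IsSMSN.map_mixing (h : IsSMSN P U W μ S lam H) (hU : Measurable U) (hW : Measurable W)
    (hS : S.PosDef) (hH : ∀ᵐ u ∂H, 0 < u) :
    P.map U = standardSkewNormal lam Set.univ • H := by
  have hg : Measurable fun ω => Real.sqrt (U ω) • invSqrtM S *ᵥ (W ω - μ) :=
    (measurable_standardize μ S).comp (hU.prodMk hW)
  have hfst := congrArg (Measure.map Prod.fst) (h.map_standardized hU hW hS hH)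
  rwa [Measure.map_fst_prod, Measure.map_map measurable_fst (hU.prodMk hg)] at hfst

lemma IsSMSN.ae_pos (h : IsSMSN P U W μ S lam H) (hU : Measurable U) (hW : Measurable W)
    (hS : S.PosDef) (hH : ∀ᵐ u ∂H, 0 < u) : ∀ᵐ ω ∂P, 0 < U ω := by
  refine ae_of_ae_map hU.aemeasurable ?_
  rw [h.map_mixing hU hW hS hH]
  exact Measure.ae_smul_measure hH _

lemma IsSMSN.integrable_inv_sqrt (h : IsSMSN P U W μ S lam H) (hU : Measurable U)
    (hW : Measurable W) (hS : S.PosDef) (hH : ∀ᵐ u ∂H, 0 < u)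
    (hk : Integrable (fun u : ℝ => (Real.sqrt u)⁻¹) H) :
    Integrable (fun ω => (Real.sqrt (U ω))⁻¹) P := by
  refine Integrable.comp_measurable (g := fun u => (Real.sqrt u)⁻¹) ?_ hU
  rw [h.map_mixing hU hW hS hH]
  exact hk.smul_measure (measure_ne_top _ _)

lemma IsSMSN.integrable [IsFiniteMeasure P] (h : IsSMSN P U W μ S lam H) (hU : Measurable U)
    (hW : Measurable W) (hS : S.PosDef) (hH : ∀ᵐ u ∂H, 0 < u)
    (hk : Integrable (fun u : ℝ => (Real.sqrt u)⁻¹) H) : Integrable W P := by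
  have hg := hU.prodMk ((measurable_standardize μ S).comp (hU.prodMk hW))
  have hinteg : Integrable (fun p : ℝ × (ι → ℝ) => (Real.sqrt p.1)⁻¹ • p.2)
      (P.map fun ω => (U ω, Real.sqrt (U ω) • invSqrtM S *ᵥ (W ω - μ))) := by
    rw [h.map_standardized hU hW hS hH]
    exact hk.smul_prod (integrable_id_standardSkewNormal lam)
  have hinv := (mulVecLin (invSqrtM S)⁻¹).toContinuousLinearMap.integrable_comp
    (hinteg.comp_measurable hg)
  refine (hinv.add (integrable_const μ)).congr ((h.ae_pos hU hW hS hH).mono fun ω hω => ?_)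
  have hsqrt : Real.sqrt (U ω) ≠ 0 := Real.sqrt_ne_zero'.2 hω
  simp [smul_smul, inv_mul_cancel₀ hsqrt, mulVec_mulVec,
    nonsing_inv_mul _ (det_invSqrtM_ne_zero hS).isUnit]

end IsSMSN

/-! ### Conditional expectations from a joint density -/

section WithDensity

variable {Ω α F : Type*} [MeasurableSpace Ω] [MeasurableSpace α] [NormedAddCommGroup F]
  [NormedSpace ℝ F] {P : Measure Ω} {T : Ω → α} {μ : Measure α} {f : α → ℝ} {k : α → F}

lemma integrable_comp_iff_of_map_eq_withDensity (hT : Measurable T) (hf : Measurable f)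
    (hf0 : 0 ≤ f) (hmap : P.map T = μ.withDensity fun x => ENNReal.ofReal (f x))
    (hk : StronglyMeasurable k) :
    Integrable (fun ω => k (T ω)) P ↔ Integrable (fun x => f x • k x) μ := by
  refine (integrable_map_measure hk.aestronglyMeasurable hT.aemeasurable).symm.trans ?_
  rw [hmap, integrable_withDensity_iff_integrable_smul' hf.ennreal_ofReal
    (ae_of_all _ fun _ => ENNReal.ofReal_lt_top)]
  simp only [ENNReal.toReal_ofReal (hf0 _)]

lemma setIntegral_comp_of_map_eq_withDensity (hT : Measurable T) (hf : Measurable f)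
    (hf0 : 0 ≤ f) (hmap : P.map T = μ.withDensity fun x => ENNReal.ofReal (f x))
    (hk : StronglyMeasurable k) {s : Set α} (hs : MeasurableSet s) :
    ∫ ω in T ⁻¹' s, k (T ω) ∂P = ∫ x in s, f x • k x ∂μ := by
  rw [← setIntegral_map hs hk.aestronglyMeasurable hT.aemeasurable, hmap,
    setIntegral_withDensity_eq_setIntegral_toReal_smul hf.ennreal_ofReal
      (ae_of_all _ fun _ => ENNReal.ofReal_lt_top) _ hs]
  simp only [ENNReal.toReal_ofReal (hf0 _)]

end WithDensity

section CondExp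

variable {Ω β E F : Type*} [MeasurableSpace Ω] [mβ : MeasurableSpace β] [MeasurableSpace E]
  [NormedAddCommGroup F] [NormedSpace ℝ F] {ρ : Measure β} {ν : Measure E}
  [SFinite ν] {f : β × E → ℝ} {h : β × E → F} {G : β → F}

lemma integrable_smul_comp_fst_of_integral_smul_eq [SFinite ρ] (hf : Integrable f (ρ.prod ν))
    (hf0 : 0 ≤ f) (hh : Integrable (fun p => f p • h p) (ρ.prod ν)) (hG : StronglyMeasurable G)
    (hfG : ∀ᵐ x ∂ρ, ∫ v, f (x, v) • h (x, v) ∂ν = (∫ v, f (x, v) ∂ν) • G x) :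
    Integrable (fun p => f p • G p.1) (ρ.prod ν) := by
  have hmeas : AEStronglyMeasurable (fun p : β × E => f p • G p.1) (ρ.prod ν) :=
    hf.aestronglyMeasurable.smul (hG.comp_measurable measurable_fst).aestronglyMeasurable
  refine (integrable_prod_iff hmeas).2 ⟨?_, hh.integral_prod_left.norm.congr ?_⟩
  · exact hf.prod_right_ae.mono fun x hx => hx.smul_const (G x)
  · filter_upwards [hfG] with x hx
    simp_rw [hx, norm_smul, Real.norm_of_nonneg (integral_nonneg fun v => hf0 (x, v)),
      Real.norm_of_nonneg (hf0 _), integral_mul_const]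

variable [SFinite ρ] [CompleteSpace F] {P : Measure Ω} [IsFiniteMeasure P] {X : Ω → β} {V : Ω → E}

theorem integrable_and_condExp_ae_eq_of_map_eq_withDensity (hX : Measurable X) (hV : Measurable V)
    (hf : Measurable f) (hf0 : 0 ≤ f)
    (hmap : P.map (fun ω => (X ω, V ω)) = (ρ.prod ν).withDensity fun p => ENNReal.ofReal (f p))
    (hh : StronglyMeasurable h) (hhi : Integrable (fun ω => h (X ω, V ω)) P)
    (hG : StronglyMeasurable G)
    (hfG : ∀ᵐ x ∂ρ, ∫ v, f (x, v) • h (x, v) ∂ν = (∫ v, f (x, v) ∂ν) • G x) :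
    Integrable (fun ω => G (X ω)) P ∧
      P[fun ω => h (X ω, V ω) | mβ.comap X] =ᵐ[P] fun ω => G (X ω) := by
  have hXV := hX.prodMk hV
  have hGfst : StronglyMeasurable fun p : β × E => G p.1 := hG.comp_measurable measurable_fst
  have hfi : Integrable f (ρ.prod ν) := by
    simpa using (integrable_comp_iff_of_map_eq_withDensity hXV hf hf0 hmap
      (stronglyMeasurable_const (b := (1 : ℝ)))).1 (integrable_const 1)
  have hfh := (integrable_comp_iff_of_map_eq_withDensity hXV hf hf0 hmap hh).1 hhi
  have hfGi := integrable_smul_comp_fst_of_integral_smul_eq hfi hf0 hfh hG hfG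
  have hGX : Integrable (fun ω => G (X ω)) P :=
    (integrable_comp_iff_of_map_eq_withDensity hXV hf hf0 hmap hGfst).2 hfGi
  refine ⟨hGX, (ae_eq_condExp_of_forall_setIntegral_eq hX.comap_le hhi
    (fun _ _ _ => hGX.integrableOn) ?_
    (hG.comp_measurable (comap_measurable X)).aestronglyMeasurable).symm⟩
  rintro s ⟨t, ht, rfl⟩ -
  have hpre : X ⁻¹' t = (fun ω => (X ω, V ω)) ⁻¹' (t ×ˢ Set.univ) := by ext; simp
  have hmt : MeasurableSet (t ×ˢ (Set.univ : Set E)) := ht.prod MeasurableSet.univ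
  rw [hpre, setIntegral_comp_of_map_eq_withDensity hXV hf hf0 hmap hGfst hmt,
    setIntegral_comp_of_map_eq_withDensity hXV hf hf0 hmap hh hmt,
    setIntegral_prod _ hfh.integrableOn, setIntegral_prod _ hfGi.integrableOn]
  refine setIntegral_congr_ae ht (hfG.mono fun x hx _ => ?_)
  simp only [Measure.restrict_univ, integral_smul_const, hx]

end CondExp

/-! ### Conditional means and the minimum mean squared error predictor -/

section Conditional

variable {Ω α γ : Type*} {mΩ : MeasurableSpace Ω} [MeasurableSpace α]
  [StandardBorelSpace α] [Nonempty α] [mγ : MeasurableSpace γ] {P : Measure Ω} [IsFiniteMeasure P]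
  {U : Ω → α} {Y : Ω → γ}

lemma ae_integrable_condDistrib {F : Type*} [NormedAddCommGroup F] {g : γ × α → F}
    (hU : Measurable U) (hY : Measurable Y) (hg : StronglyMeasurable g)
    (hgi : Integrable (fun ω => g (Y ω, U ω)) P) :
    ∀ᵐ y ∂(P.map Y), Integrable (fun u => g (y, u)) (condDistrib U Y P y) :=
  Integrable.condDistrib_ae_map hU.aemeasurable
    ((integrable_map_measure hg.aestronglyMeasurable (hY.prodMk hU).aemeasurable).2 hgi)

lemma measurable_condMean {q : ℕ} (V : Ω → Fin q → ℝ) (Y : Ω → γ) : Measurable (condMean P V Y) :=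
  (StronglyMeasurable.integral_condDistrib (f := fun p : γ × (Fin q → ℝ) => p.2)
    measurable_snd.stronglyMeasurable).measurable

lemma condExp_ae_eq_condMean {q : ℕ} {V : Ω → Fin q → ℝ} (hY : Measurable Y)
    (hV : Integrable V P) : P[V | mγ.comap Y] =ᵐ[P] fun ω => condMean P V Y (Y ω) :=
  condExp_ae_eq_integral_condDistrib' hY hV

theorem condMean_ae_eq_integral_condDistrib {q : ℕ} {V : Ω → Fin q → ℝ}
    {G : α × γ → Fin q → ℝ} (hU : Measurable U) (hY : Measurable Y) (hG : StronglyMeasurable G)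
    (hGi : Integrable (fun ω => G (U ω, Y ω)) P)
    (hVG : P[V | MeasurableSpace.comap (fun ω => (U ω, Y ω)) inferInstance] =ᵐ[P]
      fun ω => G (U ω, Y ω)) (hV : Integrable V P) :
    ∀ᵐ y ∂(P.map Y), condMean P V Y y = ∫ u, G (u, y) ∂(condDistrib U Y P y) := by
  have hGswap : StronglyMeasurable fun p : γ × α => G p.swap := hG.comp_measurable measurable_swap
  have hle : mγ.comap Y ≤ MeasurableSpace.comap (fun ω => (U ω, Y ω)) inferInstance :=
    (measurable_snd.comp (comap_measurable fun ω => (U ω, Y ω))).comap_le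
  have htower : P[V | mγ.comap Y] =ᵐ[P] P[fun ω => G (U ω, Y ω) | mγ.comap Y] :=
    (condExp_condExp_of_le hle (hU.prodMk hY).comap_le).symm.trans (condExp_congr_ae hVG)
  have hdisint := condExp_prod_ae_eq_integral_condDistrib hY hU.aemeasurable hGswap hGi
  refine (ae_map_iff hY.aemeasurable (measurableSet_eq_fun (measurable_condMean V Y)
    (hGswap.integral_condDistrib (Y := U) (X := Y) (μ := P)).measurable)).2 ?_
  filter_upwards [condExp_ae_eq_condMean hY hV, htower, hdisint] with ω h₁ h₂ h₃
  exact h₁.symm.trans (h₂.trans h₃)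

theorem condMean_ae_eq_integral_condMean_prodMk {q : ℕ} {V : Ω → Fin q → ℝ} (hU : Measurable U)
    (hY : Measurable Y) (hV : Integrable V P) :
    ∀ᵐ y ∂(P.map Y), condMean P V Y y =
      ∫ u, condMean P V (fun ω => (U ω, Y ω)) (u, y) ∂(condDistrib U Y P y) :=
  have hcond := condExp_ae_eq_condMean (hU.prodMk hY) hV
  condMean_ae_eq_integral_condDistrib hU hY (measurable_condMean V _).stronglyMeasurable
    (integrable_condExp.congr hcond) hcond hV

end Conditional

section MSE

variable {Ω : Type*} {mΩ : MeasurableSpace Ω} {P : Measure Ω} {q k : ℕ} {V : Ω → Fin q → ℝ}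
  {Y : Ω → Fin k → ℝ} {g h : (Fin k → ℝ) → Fin q → ℝ}

lemma mse_eq_sum (hV : Measurable V) (hY : Measurable Y) (hh : Measurable h) :
    mse P V Y h = ∑ j, ∫⁻ ω, ENNReal.ofReal ((V ω j - h (Y ω) j) ^ 2) ∂P := by
  rw [mse, ← lintegral_finsetSum _ fun j _ => by fun_prop]
  exact lintegral_congr fun ω => ENNReal.ofReal_sum_of_nonneg fun j _ => sq_nonneg _

lemma mse_comp_eq_zero_iff (hY : Measurable Y) (hg : Measurable g) (hh : Measurable h) :
    mse P (fun ω => g (Y ω)) Y h = 0 ↔ h =ᵐ[P.map Y] g := by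
  rw [mse, lintegral_eq_zero_iff (by fun_prop), Filter.EventuallyEq, Filter.EventuallyEq,
    ae_map_iff hY.aemeasurable (measurableSet_eq_fun hh hg)]
  refine Filter.eventually_congr (ae_of_all _ fun ω => ?_)
  rw [Pi.zero_apply, ENNReal.ofReal_eq_zero, (Finset.sum_nonneg fun j _ =>
    sq_nonneg _).ge_iff_eq', Finset.sum_eq_zero_iff_of_nonneg fun j _ => sq_nonneg _, funext_iff]
  simp [sub_eq_zero, eq_comm]

variable [IsProbabilityMeasure P]

lemma lintegral_sq_eq_lintegral_sub_condExp_sq_add {m : MeasurableSpace Ω} (hm : m ≤ mΩ)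
    {Z : Ω → ℝ} (hZ : MemLp Z 2 P) :
    ∫⁻ ω, ENNReal.ofReal (Z ω ^ 2) ∂P =
      ∫⁻ ω, ENNReal.ofReal ((Z ω - P[Z | m] ω) ^ 2) ∂P +
        ∫⁻ ω, ENNReal.ofReal (P[Z | m] ω ^ 2) ∂P := by
  have hcond : MemLp (P[Z | m]) 2 P := hZ.condExp one_le_two
  have hresid : Integrable (fun ω => (Z ω - P[Z | m] ω) ^ 2) P := (hZ.sub hcond).integrable_sq
  have hvar := integral_condVar_add_variance_condExp hm hZ
  rw [condVar, integral_condExp hm, variance_eq_sub hcond, variance_eq_sub hZ,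
    integral_condExp hm] at hvar
  simp only [Pi.pow_apply, Pi.sub_apply] at hvar
  rw [← ofReal_integral_eq_lintegral_ofReal hZ.integrable_sq (ae_of_all _ fun _ => sq_nonneg _),
    ← ofReal_integral_eq_lintegral_ofReal hresid (ae_of_all _ fun _ => sq_nonneg _),
    ← ofReal_integral_eq_lintegral_ofReal hcond.integrable_sq (ae_of_all _ fun _ => sq_nonneg _),
    ← ENNReal.ofReal_add (integral_nonneg fun _ => sq_nonneg _)
      (integral_nonneg fun _ => sq_nonneg _)]
  congr 1
  linarith

lemma lintegral_sub_sq_eq_add_of_stronglyMeasurable {m : MeasurableSpace Ω} (hm : m ≤ mΩ)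
    {V W : Ω → ℝ} (hV : Integrable V P) (hW : StronglyMeasurable[m] W)
    (hVW : MemLp (fun ω => V ω - W ω) 2 P) :
    ∫⁻ ω, ENNReal.ofReal ((V ω - W ω) ^ 2) ∂P =
      ∫⁻ ω, ENNReal.ofReal ((V ω - P[V | m] ω) ^ 2) ∂P +
        ∫⁻ ω, ENNReal.ofReal ((P[V | m] ω - W ω) ^ 2) ∂P := by
  have hWi : Integrable W P :=
    (hV.sub (hVW.integrable one_le_two)).congr (ae_of_all _ fun ω => by simp)
  have hcond : P[fun ω => V ω - W ω | m] =ᵐ[P] fun ω => P[V | m] ω - W ω := by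
    filter_upwards [condExp_sub hV hWi m] with ω hω
    rw [← congrFun (condExp_of_stronglyMeasurable hm hW hWi) ω]
    exact hω
  rw [lintegral_sq_eq_lintegral_sub_condExp_sq_add hm hVW]
  congr 1 <;> refine lintegral_congr_ae (hcond.mono fun ω hω => ?_)
  · simp only [hω, sub_sub_sub_cancel_right]
  · simp only [hω]

theorem mse_eq_mse_condMean_add (hV : Measurable V) (hVi : Integrable V P) (hY : Measurable Y)
    (hh : Measurable h) (hfin : mse P V Y h ≠ ∞) :
    mse P V Y h = mse P V Y (condMean P V Y) + mse P (fun ω => condMean P V Y (Y ω)) Y h := by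
  have hg := measurable_condMean (P := P) V Y
  rw [mse_eq_sum hV hY hh] at hfin ⊢
  rw [mse_eq_sum hV hY hg, mse_eq_sum (V := fun ω => condMean P V Y (Y ω)) (hg.comp hY) hY hh,
    ← Finset.sum_add_distrib]
  refine Finset.sum_congr rfl fun j hj => ?_
  have hcond : P[fun ω => V ω j | MeasurableSpace.comap Y MeasurableSpace.pi] =ᵐ[P]
      fun ω => condMean P V Y (Y ω) j := by
    filter_upwards [(ContinuousLinearMap.proj (R := ℝ) j).comp_condExp_comm hVi,
      condExp_ae_eq_condMean hY hVi] with ω hproj hω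
    exact hproj.symm.trans (congrFun hω j)
  have hL2 : MemLp (fun ω => V ω j - h (Y ω) j) 2 P := by
    rw [memLp_two_iff_integrable_sq (by fun_prop)]
    refine ⟨by fun_prop, ?_⟩
    rw [hasFiniteIntegral_iff_ofReal (ae_of_all _ fun _ => sq_nonneg _)]
    exact (ENNReal.sum_ne_top.1 hfin j hj).lt_top
  have hhY : Measurable[MeasurableSpace.comap Y MeasurableSpace.pi] fun ω => h (Y ω) j :=
    ((measurable_pi_apply j).comp hh).comp (comap_measurable Y)
  rw [lintegral_sub_sq_eq_add_of_stronglyMeasurable hY.comap_le (hVi.eval j)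
    hhY.stronglyMeasurable hL2]
  congr 1 <;> exact lintegral_congr_ae (hcond.mono fun ω hω => by simp only [hω])

theorem isMinMSEPredictor_condMean (hV : Measurable V) (hVi : Integrable V P)
    (hY : Measurable Y) : IsMinMSEPredictor P V Y (condMean P V Y) := by
  have hg := measurable_condMean (P := P) V Y
  refine ⟨hg, fun h hh => ⟨?_, fun hgfin heq => ?_⟩⟩
  · rcases eq_or_ne (mse P V Y h) ∞ with hinf | hfin
    · exact hinf ▸ le_top
    · exact mse_eq_mse_condMean_add hV hVi hY hh hfin ▸ le_self_add
  · have hpyth := mse_eq_mse_condMean_add hV hVi hY hh (heq ▸ hgfin)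
    rw [heq] at hpyth
    exact (mse_comp_eq_zero_iff hY hg hh).1
      ((ENNReal.add_right_inj hgfin).1 (hpyth.symm.trans (add_zero _).symm))

end MSE

/-! ### The joint law of the mixing factor, the response and the random effects -/

lemma measurable_sumElim {ι κ : Type*} :
    Measurable fun p : (ι → ℝ) × (κ → ℝ) => (Sum.elim p.1 p.2 : ι ⊕ κ → ℝ) :=
  (MeasurableEquiv.sumPiEquivProdPi fun _ : ι ⊕ κ => ℝ).symm.measurable

section LinearResponse

variable {α β ι κ Ω : Type*} [MeasurableSpace α] [MeasurableSpace β] [Fintype ι]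

lemma map_withDensity_comp_of_measurePreserving {μ : Measure α} {ν : Measure β} {F : α → β}
    {g : β → ℝ≥0∞} (hF : MeasurePreserving F μ ν) (hg : Measurable g) :
    (μ.withDensity (g ∘ F)).map F = ν.withDensity g := by
  ext s hs
  rw [Measure.map_apply hF.measurable hs, withDensity_apply _ (hF.measurable hs),
    withDensity_apply _ hs, ← hF.setLIntegral_comp_preimage hs hg]
  rfl

/-- The map `(u, (x, z)) ↦ ((u, a + Z x + z), x)`, which sends a mixing factor, random effects and
errors to the mixing factor, the response and the random effects. -/
def linearResponse (a : κ → ℝ) (Z : Matrix κ ι ℝ) (p : α × (ι ⊕ κ → ℝ)) :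
    (α × (κ → ℝ)) × (ι → ℝ) :=
  ((p.1, a + Z *ᵥ (p.2 ∘ Sum.inl) + p.2 ∘ Sum.inr), p.2 ∘ Sum.inl)

variable [Fintype κ]

lemma measurePreserving_linearResponse (H : Measure α) [SFinite H] (a : κ → ℝ)
    (Z : Matrix κ ι ℝ) :
    MeasurePreserving (linearResponse a Z) (H.prod volume) ((H.prod volume).prod volume) := by
  have hcont : Continuous fun p : (ι → ℝ) × (κ → ℝ) => a + Z *ᵥ p.1 + p.2 := by fun_prop
  have hshear : MeasurePreserving (fun p : (ι → ℝ) × (κ → ℝ) => (p.1, a + Z *ᵥ p.1 + p.2))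
      (volume.prod volume) (volume.prod volume) :=
    (MeasurePreserving.id volume).skew_product (g := fun x z => a + Z *ᵥ x + z) hcont.measurable
      (ae_of_all _ fun x => map_add_left_eq_self _ _)
  have hassoc : MeasurePreserving
      (MeasurableEquiv.prodAssoc (α := α) (β := κ → ℝ) (γ := ι → ℝ)).symm
      (H.prod (volume.prod volume)) ((H.prod volume).prod volume) :=
    MeasurePreserving.symm _ ⟨MeasurableEquiv.measurable _, Measure.prodAssoc_prod⟩
  exact hassoc.comp ((MeasurePreserving.id H).prod
    ((Measure.measurePreserving_swap.comp hshear).comp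
      (volume_measurePreserving_sumPiEquivProdPi fun _ : ι ⊕ κ => ℝ)))

variable [MeasurableSpace Ω] {P : Measure Ω} {H : Measure α} [SFinite H] {U : Ω → α}
  {b : Ω → ι → ℝ} {e Y : Ω → κ → ℝ}

theorem map_eq_withDensity_of_linearResponse (hU : Measurable U) (hb : Measurable b)
    (he : Measurable e) {a : κ → ℝ} {Z : Matrix κ ι ℝ} (hY : ∀ ω, Y ω = a + Z *ᵥ b ω + e ω)
    {f : α × (ι ⊕ κ → ℝ) → ℝ≥0∞} (hf : Measurable f)
    (hmap : P.map (fun ω => (U ω, Sum.elim (b ω) (e ω))) = (H.prod volume).withDensity f) :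
    P.map (fun ω => ((U ω, Y ω), b ω)) =
      ((H.prod volume).prod volume).withDensity
        fun p => f (p.1.1, Sum.elim p.2 (p.1.2 - a - Z *ᵥ p.2)) := by
  have hF := measurePreserving_linearResponse H a Z
  have hg : Measurable fun p : (α × (κ → ℝ)) × (ι → ℝ) =>
      f (p.1.1, Sum.elim p.2 (p.1.2 - a - Z *ᵥ p.2)) :=
    hf.comp (measurable_fst.fst.prodMk (measurable_sumElim.comp (measurable_snd.prodMk
      ((measurable_fst.snd.sub_const a).sub
        ((by fun_prop : Continuous fun x : ι → ℝ => Z *ᵥ x).measurable.comp measurable_snd)))))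
  have hfF : f = (fun p : (α × (κ → ℝ)) × (ι → ℝ) =>
      f (p.1.1, Sum.elim p.2 (p.1.2 - a - Z *ᵥ p.2))) ∘ linearResponse a Z := by
    ext ⟨u, w⟩
    simp only [Function.comp_apply, linearResponse]
    rw [add_assoc, add_sub_cancel_left, add_sub_cancel_left, Sum.elim_comp_inl_inr]
  have hcomp : (fun ω => ((U ω, Y ω), b ω)) =
      linearResponse a Z ∘ fun ω => (U ω, Sum.elim (b ω) (e ω)) := by
    ext1 ω
    rw [Function.comp_apply, linearResponse, hY, Sum.elim_comp_inl, Sum.elim_comp_inr]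
  have hUW : Measurable fun ω => (U ω, Sum.elim (b ω) (e ω)) :=
    hU.prodMk (measurable_sumElim.comp (hb.prodMk he))
  rw [hcomp, ← Measure.map_map hF.measurable hUW, hmap,
    ← map_withDensity_comp_of_measurePreserving hF hg, ← hfF]

end LinearResponse

/-! ### The conditional law of the random effects of a single subject -/

/-- The parameters of the linear mixed model `Y = offset + Z b + e` of a single subject, in which
`(b, e)` is SMSN with location `(loc, 0)`, scale matrix `diag(D, Sig)` and skewness `(lam, 0)`.
The location of `b` is a free parameter, whereas `Params` fixes it at `c Δ`. -/
structure SubjectParams (ι κ : Type*) where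
  /-- the fixed effects part of the mean response -/
  offset : κ → ℝ
  /-- the random effects design matrix -/
  Z : Matrix κ ι ℝ
  /-- the location of the random effects -/
  loc : ι → ℝ
  /-- the scale matrix of the random effects -/
  D : Matrix ι ι ℝ
  /-- the scale matrix of the errors -/
  Sig : Matrix κ κ ℝ
  /-- the skewness parameter -/
  lam : ι → ℝ
  posDef_D : D.PosDef
  posDef_Sig : Sig.PosDef

namespace SubjectParams

variable {ι κ : Type*} [Fintype ι] (M : SubjectParams ι κ)

/-- The scale matrix `Ψ = Σ + Z D Zᵀ` of the response. -/
def Psi : Matrix κ κ ℝ := M.Sig + M.Z * M.D * M.Zᵀ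

lemma posDef_Psi [Finite κ] : M.Psi.PosDef := by
  cases nonempty_fintype κ
  refine M.posDef_Sig.add_posSemidef ?_
  simpa using M.posDef_D.posSemidef.mul_mul_conjTranspose_same M.Z

variable [Fintype κ] [DecidableEq κ]

/-- The posterior location `μ_b = loc + D Zᵀ Ψ⁻¹ (y - offset - Z loc)` of the random effects. -/
def muB (y : κ → ℝ) : ι → ℝ :=
  M.loc + (M.D * M.Zᵀ * M.Psi⁻¹) *ᵥ (y - M.offset - M.Z *ᵥ M.loc)

lemma continuous_muB : Continuous M.muB := by
  unfold muB
  fun_prop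

variable [DecidableEq ι]

/-- The scaled skewness `ζ = D^{-1/2} lam`. -/
def zeta : ι → ℝ := invSqrtM M.D *ᵥ M.lam

/-- The posterior precision matrix `Λ⁻¹ = D⁻¹ + Zᵀ Σ⁻¹ Z` of the random effects. -/
def precision : Matrix ι ι ℝ := M.D⁻¹ + M.Zᵀ * M.Sig⁻¹ * M.Z

/-- The posterior scale `√(1 + ζᵀ Λ ζ)`. -/
def s : ℝ := Real.sqrt (1 + M.zeta ⬝ᵥ M.precision⁻¹ *ᵥ M.zeta)

/-- The skewing argument `A = ζᵀ (μ_b - loc) / √(1 + ζᵀ Λ ζ)`, which is the inner product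
`λ̄ᵀ y₀` of the paper (see `Params.A_eq_subject`). -/
def A (y : κ → ℝ) : ℝ := M.zeta ⬝ᵥ (M.muB y - M.loc) / M.s

lemma posDef_precision : M.precision.PosDef := by
  refine M.posDef_D.inv.add_posSemidef ?_
  simpa using M.posDef_Sig.inv.posSemidef.conjTranspose_mul_mul_same M.Z

lemma s_pos : 0 < M.s := by
  have h := M.posDef_precision.inv.posSemidef.dotProduct_mulVec_nonneg M.zeta
  rw [star_trivial] at h
  exact Real.sqrt_pos.2 (add_pos_of_pos_of_nonneg one_pos h)

lemma precision_mulVec_muB_sub_loc (y : κ → ℝ) :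
    M.precision *ᵥ (M.muB y - M.loc) =
      (M.Zᵀ * M.Sig⁻¹) *ᵥ (y - M.offset - M.Z *ᵥ M.loc) := by
  rw [muB, add_sub_cancel_left, mulVec_mulVec, precision, Psi,
    inv_add_mul_mul_mul_inv M.posDef_D.det_pos.ne'.isUnit M.posDef_Sig.det_pos.ne'.isUnit
      M.posDef_Psi.det_pos.ne'.isUnit]

lemma continuous_A : Continuous M.A := by
  have := M.continuous_muB
  unfold A
  fun_prop

/-- The joint density of `(b, e)` given `U = u`, at the random effects `x` and the errors
`y - offset - Z x` that are compatible with the response `y`. -/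
def jointPDF (u : ℝ) (y : κ → ℝ) (x : ι → ℝ) : ℝ :=
  scaledSkewNormalPDF (Sum.elim M.loc 0) (fromBlocks M.D 0 0 M.Sig) (Sum.elim M.lam 0) u
    (Sum.elim x (y - M.offset - M.Z *ᵥ x))

lemma jointPDF_nonneg (u : ℝ) (y : κ → ℝ) (x : ι → ℝ) : 0 ≤ M.jointPDF u y x :=
  scaledSkewNormalPDF_nonneg (posDef_fromBlocks_diagonal M.posDef_D M.posDef_Sig) _ _ _ _

lemma measurable_jointPDF :
    Measurable fun p : (ℝ × (κ → ℝ)) × (ι → ℝ) => M.jointPDF p.1.1 p.1.2 p.2 := by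
  have herr : Measurable fun p : (ℝ × (κ → ℝ)) × (ι → ℝ) => p.1.2 - M.offset - M.Z *ᵥ p.2 :=
    (by fun_prop : Continuous fun p : (ℝ × (κ → ℝ)) × (ι → ℝ) =>
      p.1.2 - M.offset - M.Z *ᵥ p.2).measurable
  have harg : Measurable fun p : (ℝ × (κ → ℝ)) × (ι → ℝ) =>
      (p.1.1, Sum.elim p.2 (p.1.2 - M.offset - M.Z *ᵥ p.2)) :=
    measurable_fst.fst.prodMk (measurable_sumElim.comp (measurable_snd.prodMk herr))
  have hpdf := measurable_scaledSkewNormalPDF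
    (posDef_fromBlocks_diagonal M.posDef_D M.posDef_Sig) (Sum.elim M.loc 0) (Sum.elim M.lam 0)
  simpa only [jointPDF, Function.comp_def] using hpdf.comp harg

theorem exists_jointPDF_eq_skewGaussian (u : ℝ) (y : κ → ℝ) :
    ∃ C, ∀ x, M.jointPDF u y x =
      C * skewGaussian (u • M.precision) (Real.sqrt u * (M.zeta ⬝ᵥ (M.muB y - M.loc)))
        (Real.sqrt u • M.zeta) (x - M.muB y) := by
  set d := y - M.offset - M.Z *ᵥ M.loc with hd
  set r := M.muB y - M.loc with hr
  have hprec : u • M.D⁻¹ + M.Zᵀ * (u • M.Sig⁻¹) * M.Z = u • M.precision := by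
    rw [precision, smul_add, Matrix.mul_smul, Matrix.smul_mul]
  have hnormal : (u • M.D⁻¹ + M.Zᵀ * (u • M.Sig⁻¹) * M.Z) *ᵥ r =
      (M.Zᵀ * (u • M.Sig⁻¹)) *ᵥ d := by
    rw [hprec, Matrix.mul_smul, smul_mulVec, smul_mulVec, precision_mulVec_muB_sub_loc]
  have hD : (u • M.D⁻¹).IsHermitian := M.posDef_D.inv.isHermitian.smul (IsSelfAdjoint.all u)
  have hSig : (u • M.Sig⁻¹).IsHermitian := M.posDef_Sig.inv.isHermitian.smul (IsSelfAdjoint.all u)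
  refine ⟨scaledSkewNormalConst (fromBlocks M.D 0 0 M.Sig) u *
    Real.exp (-(d ⬝ᵥ (u • M.Sig⁻¹) *ᵥ d - r ⬝ᵥ (u • M.precision) *ᵥ r) / 2), fun x => ?_⟩
  have hw : Sum.elim x (y - M.offset - M.Z *ᵥ x) - Sum.elim M.loc 0 =
      Sum.elim (x - M.loc) (d - M.Z *ᵥ (x - M.loc)) := by
    rw [← Sum.elim_sub_sub, sub_zero, hd, mulVec_sub]
    congr 1
    abel
  have hscale : u • (fromBlocks M.D 0 0 M.Sig)⁻¹ = fromBlocks (u • M.D⁻¹) 0 0 (u • M.Sig⁻¹) := by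
    rw [inv_fromBlocks_diagonal M.posDef_D M.posDef_Sig, fromBlocks_smul, smul_zero, smul_zero]
  have hskew : Real.sqrt u • invSqrtM (fromBlocks M.D 0 0 M.Sig) *ᵥ Sum.elim M.lam 0 =
      Sum.elim (Real.sqrt u • M.zeta) (0 : κ → ℝ) := by
    rw [invSqrtM_fromBlocks_diagonal M.posDef_D M.posDef_Sig, fromBlocks_mulVec]
    ext (j | j) <;> simp [zeta]
  rw [jointPDF, scaledSkewNormalPDF_eq (posDef_fromBlocks_diagonal M.posDef_D M.posDef_Sig), hw,
    hscale, hskew, skewGaussian_fromBlocks_sumElim_sub hD hSig 0 (Real.sqrt u • M.zeta) M.Z d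
      (x - M.loc) r hnormal, hprec, hr, sub_sub_sub_cancel_right, zero_add, smul_dotProduct,
    smul_eq_mul, ← mul_assoc]

theorem integral_jointPDF_smul_id {u : ℝ} (hu : 0 < u) (y : κ → ℝ) :
    ∫ x, M.jointPDF u y x • x =
      (∫ x, M.jointPDF u y x) •
        (M.muB y + (tauIntegrand (M.A y) u / M.s) • M.precision⁻¹ *ᵥ M.zeta) := by
  obtain ⟨C, hC⟩ := M.exists_jointPDF_eq_skewGaussian u y
  have hL : (u • M.precision).PosDef := M.posDef_precision.smul hu
  have hLinv : (u • M.precision)⁻¹ *ᵥ (Real.sqrt u • M.zeta) =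
      (Real.sqrt u)⁻¹ • M.precision⁻¹ *ᵥ M.zeta := by
    have := invertibleOfNonzero hu.ne'
    rw [inv_smul _ u M.posDef_precision.det_pos.ne'.isUnit, invOf_eq_inv, smul_mulVec,
      mulVec_smul, smul_smul, ← div_eq_inv_mul, Real.sqrt_div_self]
  have hs : Real.sqrt (1 + (Real.sqrt u • M.zeta) ⬝ᵥ (u • M.precision)⁻¹ *ᵥ
      (Real.sqrt u • M.zeta)) = M.s := by
    rw [hLinv, smul_dotProduct, dotProduct_smul, smul_smul,
      mul_inv_cancel₀ (Real.sqrt_pos.2 hu).ne', one_smul, s]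
  simp_rw [hC, mul_smul, integral_smul, integral_const_mul]
  rw [integral_skewGaussian_sub_smul_id hL, hs, hLinv, tauIntegrand, A,
    mul_smul, mul_div_assoc, mul_comm (Real.sqrt u)⁻¹, mul_div_right_comm, mul_smul]

end SubjectParams

lemma measurable_tauIntegrand_uncurry : Measurable fun p : ℝ × ℝ => tauIntegrand p.1 p.2 := by
  have hcdf := continuous_stdNormalCDF.measurable
  unfold tauIntegrand WPhi
  fun_prop

namespace SubjectParams

/-- The random effects `b`, errors `e`, mixing factor `U` and response `Y` of a subject follow the
model `M`: `Y = offset + Z b + e`, and `(b, e)` is SMSN with location `(loc, 0)`, scale matrix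
`diag(D, Sig)`, skewness `(lam, 0)` and a positive mixing factor `U` of law `H` with
`E[U^{-1/2}] < ∞`. -/
structure IsModel {Ω ι κ : Type*} [MeasurableSpace Ω] [Fintype ι] [Fintype κ] [DecidableEq ι]
    [DecidableEq κ] (M : SubjectParams ι κ) (P : Measure Ω) (H : Measure ℝ) (b : Ω → ι → ℝ)
    (e : Ω → κ → ℝ) (U : Ω → ℝ) (Y : Ω → κ → ℝ) : Prop where
  measurable_b : Measurable b
  measurable_e : Measurable e
  measurable_U : Measurable U
  response : ∀ ω, Y ω = M.offset + M.Z *ᵥ b ω + e ω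
  smsn : IsSMSN P U (fun ω => Sum.elim (b ω) (e ω)) (Sum.elim M.loc 0)
    (fromBlocks M.D 0 0 M.Sig) (Sum.elim M.lam 0) H
  ae_pos : ∀ᵐ u ∂H, 0 < u
  integrable_inv_sqrt : Integrable (fun u : ℝ => (Real.sqrt u)⁻¹) H

/-- `E[b | U = u, Y = y]`, as a function of `(u, y)`. -/
def posteriorMean {ι κ : Type*} [Fintype ι] [Fintype κ] [DecidableEq ι] [DecidableEq κ]
    (M : SubjectParams ι κ) (p : ℝ × (κ → ℝ)) : ι → ℝ :=
  M.muB p.2 + (tauIntegrand (M.A p.2) p.1 / M.s) • M.precision⁻¹ *ᵥ M.zeta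

section Posterior

variable {ι κ : Type*} [Fintype ι] [Fintype κ] [DecidableEq ι] [DecidableEq κ]
  (M : SubjectParams ι κ)

lemma measurable_tauIntegrand_A :
    Measurable fun p : ℝ × (κ → ℝ) => tauIntegrand (M.A p.2) p.1 :=
  measurable_tauIntegrand_uncurry.comp
    ((M.continuous_A.measurable.comp measurable_snd).prodMk measurable_fst)

lemma stronglyMeasurable_posteriorMean : StronglyMeasurable M.posteriorMean := by
  have hmuB := M.continuous_muB.measurable
  have htau := M.measurable_tauIntegrand_A
  unfold posteriorMean
  exact ((hmuB.comp measurable_snd).add ((htau.div_const _).smul_const _)).stronglyMeasurable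

end Posterior

namespace IsModel

variable {Ω ι κ : Type*} [MeasurableSpace Ω] [Fintype ι] [Fintype κ] [DecidableEq ι]
  [DecidableEq κ] {M : SubjectParams ι κ} {P : Measure Ω} {H : Measure ℝ} {b : Ω → ι → ℝ}
  {e : Ω → κ → ℝ} {U : Ω → ℝ} {Y : Ω → κ → ℝ}

lemma measurable_sumElim (hM : M.IsModel P H b e U Y) :
    Measurable fun ω => Sum.elim (b ω) (e ω) :=
  SkewLMM.measurable_sumElim.comp (hM.measurable_b.prodMk hM.measurable_e)

lemma measurable_Y (hM : M.IsModel P H b e U Y) : Measurable Y := by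
  have hcont : Continuous fun p : (ι → ℝ) × (κ → ℝ) => M.offset + M.Z *ᵥ p.1 + p.2 := by fun_prop
  rw [funext hM.response]
  exact hcont.measurable.comp (hM.measurable_b.prodMk hM.measurable_e)

lemma map_prodMk (hM : M.IsModel P H b e U Y) [SFinite H] :
    P.map (fun ω => ((U ω, Y ω), b ω)) = ((H.prod volume).prod volume).withDensity
      fun p => ENNReal.ofReal (M.jointPDF p.1.1 p.1.2 p.2) := by
  have hpdf := measurable_scaledSkewNormalPDF
    (posDef_fromBlocks_diagonal M.posDef_D M.posDef_Sig) (Sum.elim M.loc 0) (Sum.elim M.lam 0)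
  simpa only [jointPDF] using map_eq_withDensity_of_linearResponse hM.measurable_U
    hM.measurable_b hM.measurable_e hM.response hpdf.ennreal_ofReal hM.smsn

variable [IsFiniteMeasure P]

lemma integrable_b (hM : M.IsModel P H b e U Y) : Integrable b P := by
  have hW := hM.smsn.integrable hM.measurable_U hM.measurable_sumElim
    (posDef_fromBlocks_diagonal M.posDef_D M.posDef_Sig) hM.ae_pos hM.integrable_inv_sqrt
  exact Integrable.of_eval fun j => hW.eval (Sum.inl j)

theorem integrable_posteriorMean_and_condExp_ae_eq (hM : M.IsModel P H b e U Y) [SFinite H] :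
    Integrable (fun ω => M.posteriorMean (U ω, Y ω)) P ∧
      P[b | MeasurableSpace.comap (fun ω => (U ω, Y ω)) inferInstance] =ᵐ[P]
        fun ω => M.posteriorMean (U ω, Y ω) := by
  refine integrable_and_condExp_ae_eq_of_map_eq_withDensity (h := fun p => p.2)
    (hM.measurable_U.prodMk hM.measurable_Y) hM.measurable_b M.measurable_jointPDF
    (fun p => M.jointPDF_nonneg _ _ _) hM.map_prodMk measurable_snd.stronglyMeasurable
    hM.integrable_b M.stronglyMeasurable_posteriorMean ?_
  filter_upwards [Measure.quasiMeasurePreserving_fst.ae hM.ae_pos] with p hp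
  exact M.integral_jointPDF_smul_id hp p.2

lemma ae_integrable_tauIntegrand (hM : M.IsModel P H b e U Y) [SFinite H] :
    ∀ᵐ y ∂(P.map Y), Integrable (tauIntegrand (M.A y)) (condDistrib U Y P y) := by
  rcases eq_or_ne M.zeta 0 with hζ | hζ
  · have hinv := hM.smsn.integrable_inv_sqrt hM.measurable_U hM.measurable_sumElim
      (posDef_fromBlocks_diagonal M.posDef_D M.posDef_Sig) hM.ae_pos hM.integrable_inv_sqrt
    have hmeas : StronglyMeasurable fun p : (κ → ℝ) × ℝ => (Real.sqrt p.2)⁻¹ :=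
      (by fun_prop : Measurable _).stronglyMeasurable
    filter_upwards [ae_integrable_condDistrib hM.measurable_U hM.measurable_Y hmeas hinv]
      with y hy
    simpa +unfoldPartialApp [tauIntegrand, A, hζ] using hy.mul_const (WPhi 0)
  · have hΛζ : M.precision⁻¹ *ᵥ M.zeta ≠ 0 := fun h0 => hζ
      (mulVec_injective_of_isUnit M.posDef_precision.inv.isUnit (h0.trans (mulVec_zero _).symm))
    have hmeas : StronglyMeasurable fun p : (κ → ℝ) × ℝ => M.posteriorMean p.swap :=
      M.stronglyMeasurable_posteriorMean.comp_measurable measurable_swap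
    filter_upwards [ae_integrable_condDistrib hM.measurable_U hM.measurable_Y hmeas
      hM.integrable_posteriorMean_and_condExp_ae_eq.1] with y hy
    have hdiff := hy.sub (integrable_const (M.muB y))
    have htau : Integrable (fun u => tauIntegrand (M.A y) u / M.s) (condDistrib U Y P y) := by
      refine (integrable_smul_const hΛζ).1 (hdiff.congr (ae_of_all _ fun u => ?_))
      simp [posteriorMean]
    simpa [M.s_pos.ne'] using htau.mul_const M.s

end IsModel

theorem IsModel.condMean_ae_eq {q k : ℕ} {Ω : Type*} [MeasurableSpace Ω]
    {M : SubjectParams (Fin q) (Fin k)} {P : Measure Ω} [IsFiniteMeasure P] {H : Measure ℝ}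
    [SFinite H] {b : Ω → Fin q → ℝ} {e : Ω → Fin k → ℝ} {U : Ω → ℝ} {Y : Ω → Fin k → ℝ}
    (hM : M.IsModel P H b e U Y) :
    ∀ᵐ y ∂(P.map Y), condMean P b Y y =
      M.muB y + (tauNegOne P U Y M.A y / M.s) • M.precision⁻¹ *ᵥ M.zeta := by
  obtain ⟨hinteg, hcond⟩ := hM.integrable_posteriorMean_and_condExp_ae_eq
  filter_upwards [hM.ae_integrable_tauIntegrand, condMean_ae_eq_integral_condDistrib
    hM.measurable_U hM.measurable_Y M.stronglyMeasurable_posteriorMean hinteg hcond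
    hM.integrable_b] with y htau hy
  simp only [hy, posteriorMean]
  rw [integral_add (integrable_const _) ((htau.div_const _).smul_const _), integral_const,
    integral_smul_const, integral_div, probReal_univ, one_smul, tauNegOne]

end SubjectParams

namespace Params

variable {n q l : ℕ} {m : Fin n → ℕ} (M : Params n q l m) (i : Fin n)

/-- The parameters of the model of subject `i`. -/
def subject : SubjectParams (Fin q) (Fin (m i)) where
  offset := M.X i *ᵥ M.beta
  Z := M.Z i
  loc := M.c • M.Delta
  D := M.D
  Sig := M.Sig i
  lam := M.lam
  posDef_D := M.posDef_D
  posDef_Sig := M.posDef_Sig i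

lemma y0_eq_subject (y : Fin (m i) → ℝ) :
    M.y0 i y = invSqrtM (M.Psi i) *ᵥ
      (y - (M.subject i).offset - (M.subject i).Z *ᵥ (M.subject i).loc) := by
  simp only [y0, subject, mulVec_smul]

lemma muB_eq_subject : M.muB i = (M.subject i).muB := by
  ext1 y
  rw [muB, y0_eq_subject, mulVec_mulVec, Matrix.mul_assoc _ (invSqrtM _),
    invSqrtM_mul_invSqrtM (S := M.Psi i) (M.subject i).posDef_Psi]
  rfl

lemma A_eq_subject : M.A i = (M.subject i).A := by
  have hsymm : (invSqrtM (M.Psi i) * M.Z i * M.D)ᵀ = M.D * (M.Z i)ᵀ * invSqrtM (M.Psi i) := by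
    have hD : M.Dᵀ = M.D := by simpa using M.posDef_D.isHermitian.eq
    rw [transpose_mul, transpose_mul, transpose_invSqrtM, hD, Matrix.mul_assoc]
  have hdiff (y) : (M.D * (M.Z i)ᵀ * invSqrtM (M.Psi i)) *ᵥ M.y0 i y =
      (M.subject i).muB y - (M.subject i).loc := by
    rw [← muB_eq_subject, muB]
    exact (add_sub_cancel_left _ _).symm
  ext1 y
  rw [A, lamBar, smul_dotProduct, dotProduct_comm, dotProduct_mulVec, ← mulVec_transpose, hsymm,
    hdiff, dotProduct_comm, smul_eq_mul, ← div_eq_inv_mul]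
  rfl

variable {M} in
lemma IsModel.subject {Ω : Type*} [MeasurableSpace Ω] {P : Measure Ω}
    {b : Fin n → Ω → Fin q → ℝ} {e : (i : Fin n) → Ω → Fin (m i) → ℝ} {U : Fin n → Ω → ℝ}
    {Y : (i : Fin n) → Ω → Fin (m i) → ℝ} (hM : M.IsModel P b e U Y) (i : Fin n) :
    (M.subject i).IsModel P M.H (b i) (e i) (U i) (Y i) where
  measurable_b := hM.measurable_b i
  measurable_e := hM.measurable_e i
  measurable_U := hM.measurable_U i
  response := hM.response i
  smsn := hM.smsn i
  ae_pos := by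
    simpa only [Set.mem_Iic, not_le] using measure_eq_zero_iff_ae_notMem.1 M.H_nonpos
  integrable_inv_sqrt := M.integrable_k1

end Params

end SkewLMM

end

theorem mainTheorem4_general {q k : ℕ} (M : SkewLMM.SubjectParams (Fin q) (Fin k))
    {Ω : Type*} [MeasurableSpace Ω] (P : Measure Ω) [IsProbabilityMeasure P] (H : Measure ℝ)
    [SFinite H] (b : Ω → Fin q → ℝ) (e : Ω → Fin k → ℝ) (U : Ω → ℝ) (Y : Ω → Fin k → ℝ)
    (hM : M.IsModel P H b e U Y) :
    Integrable b P ∧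
    SkewLMM.IsMinMSEPredictor P b Y (SkewLMM.condMean P b Y) ∧
    ∀ᵐ y ∂(P.map Y),
      Integrable (fun v : Fin q → ℝ => v) (condDistrib b Y P y) ∧
      Integrable (SkewLMM.tauIntegrand (M.A y)) (condDistrib U Y P y) ∧
      SkewLMM.condMean P b Y y =
        ∫ u, SkewLMM.condMean P b (fun ω => (U ω, Y ω)) (u, y) ∂(condDistrib U Y P y) ∧
      SkewLMM.condMean P b Y y =
        M.muB y + (SkewLMM.tauNegOne P U Y M.A y / M.s) • (M.precision⁻¹ *ᵥ M.zeta) := by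
  have hb := hM.integrable_b
  have hY := hM.measurable_Y
  refine ⟨hb, SkewLMM.isMinMSEPredictor_condMean hM.measurable_b hb hY, ?_⟩
  filter_upwards [SkewLMM.ae_integrable_condDistrib hM.measurable_b hY
      measurable_snd.stronglyMeasurable hb, hM.ae_integrable_tauIntegrand,
    SkewLMM.condMean_ae_eq_integral_condMean_prodMk hM.measurable_U hY hb, hM.condMean_ae_eq]
    with y hb hτ htower hmean
  exact ⟨hb, hτ, htower, hmean⟩

theorem mainTheorem4 {n q l : ℕ} {m : Fin n → ℕ} (M : SkewLMM.Params n q l m)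
    {Ω : Type*} [MeasurableSpace Ω] (P : Measure Ω) [IsProbabilityMeasure P]
    (b : Fin n → Ω → Fin q → ℝ) (e : (i : Fin n) → Ω → Fin (m i) → ℝ)
    (U : Fin n → Ω → ℝ) (Y : (i : Fin n) → Ω → Fin (m i) → ℝ)
    (hM : M.IsModel P b e U Y) (i : Fin n) :
    Integrable (b i) P ∧
    SkewLMM.IsMinMSEPredictor P (b i) (Y i) (SkewLMM.condMean P (b i) (Y i)) ∧
    ∀ᵐ y ∂(P.map (Y i)),
      Integrable (fun v : Fin q → ℝ => v) (condDistrib (b i) (Y i) P y) ∧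
      Integrable (SkewLMM.tauIntegrand (M.A i y)) (condDistrib (U i) (Y i) P y) ∧
      SkewLMM.condMean P (b i) (Y i) y =
        ∫ u, SkewLMM.condMean P (b i) (fun ω => (U i ω, Y i ω)) (u, y)
          ∂(condDistrib (U i) (Y i) P y) ∧
      SkewLMM.condMean P (b i) (Y i) y =
        M.muB i y +
          (SkewLMM.tauNegOne P (U i) (Y i) (M.A i) y /
            Real.sqrt (1 + M.zeta ⬝ᵥ M.Lambda i *ᵥ M.zeta)) • (M.Lambda i *ᵥ M.zeta) := by
  have := M.isProbabilityMeasure_H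
  rw [M.muB_eq_subject, M.A_eq_subject]
  exact mainTheorem4_general (M.subject i) P M.H (b i) (e i) (U i) (Y i) (hM.subject i)
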